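/- Let $\mathcal X\subset\mathbb R^d$ be a finite non-empty set, let $k:\mathcal X\times\mathcal X\to\mathbb R$ be a stationary positive semidefinite kernel with $k(x,x)=1$ for all $x\in\mathcal X$, let $f\sim\mathcal{GP}(0,k)$, and let $\sigma^2>0$. Evaluating $f$ at an input $x_t$ returns $y_t=f(x_t)+\epsilon_t$, where the noises $\epsilon_t\sim\mathcal N(0,\sigma^2)$ are independent of each other, of $f$ and of the choice of inputs so far. Let $\mathcal D_0$ be an initial dataset of $n_0\ge 0$ such noisy evaluations at fixed inputs, and let $\mathcal D_t$ be $\mathcal D_{t-1}$ extended by $(x_t,y_t)$. For $\mathcal D_{t-1}=\{(\bar x_i,\bar y_i)\}_{i=1}^n$ let $$\mu_{t-1}(x)=\mathbf k(x)^\top(\mathbf K+\sigma^2\mathbf I)^{-1}\bar{\mathbf y},\qquad \sigma_{t-1}^2(x)=k(x,x)-\mathbf k(x)^\top(\mathbf K+\sigma^2\mathbf I)^{-1}\mathbf k(x),$$ where $\mathbf k(x)=(k(x,\bar x_i))_{i\le n}$, $\mathbf K=(k(\bar x_i,\bar x_j))_{i,j\le n}$ and $\bar{\mathbf y}=(\bar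 y_i)_{i\le n}$. At each iteration $t\ge1$, the algorithm PIMS samples a path $g_t$ from the posterior $p(f\mid\mathcal D_{t-1})$ (independently of $f$ and of the noises given $\mathcal D_{t-1}$), puts $g_t^*=\max_{x\in\mathcal X}g_t(x)$, and chooses $$x_t\in\operatorname*{arg\,min}_{x\in\mathcal X}\frac{g_t^*-\mu_{t-1}(x)}{\sigma_{t-1}(x)},$$ ties being broken by any (measurable, possibly randomized) rule that depends on $\mathcal D_{t-1}$ and $g_t$ only. Let $\mathrm{BCR}_T=\mathbb E\bigl[\sum_{t=1}^T\bigl(\max_{x\in\mathcal X}f(x)-f(x_t)\bigr)\bigr]$, the expectation being over $f$, the noises and the randomness of the algorithm. Let $\gamma_T=\max_{a_1,\dots,a_T\in\mathcal X}I(\mathbf y_A;\mathbf f_A)$ be the maximum information gain, where repetitions among the $a_i$ are allowed, $\mathbf f_A=(f(a_i))_{i\le T}$, $\mathbf y_A=\mathbf f_A+\boldsymbol\epsilon_A$ with $\boldsymbol\epsilon_A\sim\mathcal N(0,\sigma^2\mathbf I_T)$ independent of $f$, and $I$ is the Shannon mutual information. **Theorem.** For every $T$, the cumulative regret of PIMS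 is integrable and $$\mathrm{BCR}_T\le\sqrt{C_1C_2T\gamma_T},\qquad C_1=\frac{2}{\log(1+\sigma^{-2})},\qquad C_2=2+2\log\bigl(|\mathcal X|/2\bigr).$$ -/

import Mathlib

open MeasureTheory ProbabilityTheory InformationTheory
open scoped ENNReal

noncomputable section

namespace PIMS

/-- A dataset `(x₁, y₁), …, (xₙ, yₙ)` of `n` inputs with their noisy observations. -/
abbrev Dataset (𝒳 : Type*) (n : ℕ) : Type _ := Fin n → 𝒳 × ℝ

/-- The law of the observation noise, `N(0, σ²)`. -/
def noiseLaw (σ : ℝ) : Measure ℝ := gaussianReal 0 (Real.toNNReal (σ ^ 2))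

instance (σ : ℝ) : IsProbabilityMeasure (noiseLaw σ) := by
  unfold noiseLaw; infer_instance

section Posterior

variable {𝒳 : Type*} (k : 𝒳 → 𝒳 → ℝ) (σ : ℝ) {n : ℕ} (D : Dataset 𝒳 n)

/-- The regularized kernel matrix `K + σ² I` of a dataset. -/
def regGram : Matrix (Fin n) (Fin n) ℝ :=
  Matrix.of (fun i j ↦ k (D i).1 (D j).1) + σ ^ 2 • (1 : Matrix (Fin n) (Fin n) ℝ)

/-- The vector `(k(x, x₁), …, k(x, xₙ))`. -/
def kvec (x : 𝒳) : Fin n → ℝ := fun i ↦ k x (D i).1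

/-- The posterior mean `k(x)ᵀ (K + σ² I)⁻¹ y`. -/
def postMean (x : 𝒳) : ℝ :=
  kvec k D x ⬝ᵥ (regGram k σ D)⁻¹.mulVec (fun i ↦ (D i).2)

/-- The posterior variance `k(x, x) - k(x)ᵀ (K + σ² I)⁻¹ k(x)`. -/
def postVar (x : 𝒳) : ℝ :=
  k x x - kvec k D x ⬝ᵥ (regGram k σ D)⁻¹.mulVec (kvec k D x)

/-- The posterior standard deviation. -/
def postStd (x : 𝒳) : ℝ := Real.sqrt (postVar k σ D x)

/-- The quantity `(g* - μ(x)) / σ(x)` that PIMS minimizes over `x`, where `g* = max g` is the maximum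
of the sampled path `g`, and `μ`, `σ` are the posterior mean and standard deviation. -/
def score (g : 𝒳 → ℝ) (x : 𝒳) : ℝ :=
  ((⨆ x', g x') - postMean k σ D x) / postStd k σ D x

end Posterior

section Data

variable {𝒳 : Type*}

/-- From design points, a path `f` and noises: the dataset `(xᵢ, f(xᵢ) + εᵢ)ᵢ`, paired with `f`. -/
def observe {n : ℕ} (x₀ : Fin n → 𝒳) (p : (𝒳 → ℝ) × (Fin n → ℝ)) :
    Dataset 𝒳 n × (𝒳 → ℝ) :=
  (fun i ↦ (x₀ i, p.1 (x₀ i) + p.2 i), p.1)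

/-- From `((D, f), x)` and a noise `e`: the dataset `D` extended by `(x, f(x) + e)`, paired with `f`. -/
def extend {n : ℕ} (p : ((Dataset 𝒳 n × (𝒳 → ℝ)) × 𝒳) × ℝ) :
    Dataset 𝒳 (n + 1) × (𝒳 → ℝ) :=
  (Fin.snoc p.1.1.1 (p.1.2, p.1.1.2 p.1.2 + p.2), p.1.1.2)

/-- The cumulative regret `∑ₜ (max f - f(xₜ))` over the `T` iterations that follow an initial dataset
of size `n₀`. -/
def regret {n₀ T : ℕ} (p : Dataset 𝒳 (n₀ + T) × (𝒳 → ℝ)) : ℝ :=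
  ∑ t : Fin T, ((⨆ x, p.2 x) - p.2 (p.1 (Fin.natAdd n₀ t)).1)

theorem measurable_observe [MeasurableSpace 𝒳] {n : ℕ} (x₀ : Fin n → 𝒳) :
    Measurable (observe x₀) := by
  unfold observe
  fun_prop

theorem measurable_extend [Finite 𝒳] [MeasurableSpace 𝒳] [MeasurableSingletonClass 𝒳] {n : ℕ} :
    Measurable (extend (𝒳 := 𝒳) (n := n)) := by
  have hev : Measurable (fun q : (𝒳 → ℝ) × 𝒳 ↦ q.1 q.2) :=
    measurable_from_prod_countable_left (fun x ↦ measurable_pi_apply x)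
  refine Measurable.prodMk (measurable_pi_lambda _ fun i ↦ ?_) (by fun_prop)
  refine Fin.lastCases ?_ (fun j ↦ ?_) i
  · simp only [Fin.snoc_last]
    have h := hev.comp (f := fun p : ((Dataset 𝒳 n × (𝒳 → ℝ)) × 𝒳) × ℝ ↦ (p.1.1.2, p.1.2))
      (by fun_prop)
    have h2 : Measurable (fun p : ((Dataset 𝒳 n × (𝒳 → ℝ)) × 𝒳) × ℝ ↦ p.1.1.2 p.1.2) := h
    exact Measurable.prodMk (by fun_prop) (h2.add measurable_snd)
  · simp only [Fin.snoc_castSucc]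
    fun_prop

end Data

section Prior

variable {𝒳 : Type*} [Fintype 𝒳]

open Classical in
/-- The law of `f ∼ GP(0, k)` on a finite domain: `(f(x))ₓ` is a centred Gaussian vector with
covariance matrix `(k(x, x'))`. -/
def gpLaw (k : 𝒳 → 𝒳 → ℝ) : Measure (𝒳 → ℝ) :=
  (multivariateGaussian 0 (Matrix.of k)).map (fun v x ↦ v x)

instance (k : 𝒳 → 𝒳 → ℝ) : IsProbabilityMeasure (gpLaw k) := by
  classical
  exact Measure.isProbabilityMeasure_map (Measurable.aemeasurable (by fun_prop))

/-- The Shannon mutual information of two random variables with joint law `ρ`: the Kullback-Leibler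
divergence of `ρ` from the product of its marginals. -/
def mutualInfo {α β : Type*} [MeasurableSpace α] [MeasurableSpace β] (ρ : Measure (α × β)) : ℝ≥0∞ :=
  klDiv ρ (ρ.fst.prod ρ.snd)

/-- The joint law of `y_A = f_A + ε_A` and `f_A` for inputs `a₁, …, a_T`, where `f ∼ GP(0, k)` and
the `εᵢ ∼ N(0, σ²)` are independent of each other and of `f`. -/
def obsLaw (k : 𝒳 → 𝒳 → ℝ) (σ : ℝ) {T : ℕ} (a : Fin T → 𝒳) :
    Measure ((Fin T → ℝ) × (Fin T → ℝ)) :=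
  ((gpLaw k).prod (Measure.pi fun _ ↦ noiseLaw σ)).map
    (fun p ↦ (fun i ↦ p.1 (a i) + p.2 i, fun i ↦ p.1 (a i)))

/-- The maximum information gain `γ_T`, the maximum of `I(y_A; f_A)` over all choices of `T` inputs,
repetitions allowed. -/
def maxInfoGain (k : 𝒳 → 𝒳 → ℝ) (σ : ℝ) (T : ℕ) : ℝ :=
  (⨆ a : Fin T → 𝒳, mutualInfo (obsLaw k σ a)).toReal

end Prior

section Run

variable {𝒳 : Type*} [Fintype 𝒳] [MeasurableSpace 𝒳] [MeasurableSingletonClass 𝒳]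

/-- The joint law of the initial dataset at the design points `x₀` and of `f ∼ GP(0, k)`. -/
def initLaw (k : 𝒳 → 𝒳 → ℝ) (σ : ℝ) {n : ℕ} (x₀ : Fin n → 𝒳) :
    Measure (Dataset 𝒳 n × (𝒳 → ℝ)) :=
  ((gpLaw k).prod (Measure.pi fun _ ↦ noiseLaw σ)).map (observe x₀)

instance (k : 𝒳 → 𝒳 → ℝ) (σ : ℝ) {n : ℕ} (x₀ : Fin n → 𝒳) :
    IsProbabilityMeasure (initLaw k σ x₀) :=
  Measure.isProbabilityMeasure_map (measurable_observe x₀).aemeasurable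

/-- The posterior `p(f ∣ D)`: the regular conditional law of `f` given the dataset, where `ρ` is the
joint law of the dataset and of `f`. -/
def posterior {n : ℕ} (ρ : Measure (Dataset 𝒳 n × (𝒳 → ℝ))) [IsFiniteMeasure ρ] :
    Kernel (Dataset 𝒳 n) (𝒳 → ℝ) := ρ.condKernel

/-- The law of the next input given the dataset `D`: sample a path `g ∼ p(f ∣ D)`, then draw the input
from `sel (D, g)`. -/
def queryKernel {n : ℕ} (ρ : Measure (Dataset 𝒳 n × (𝒳 → ℝ))) [IsFiniteMeasure ρ]
    (sel : Kernel (Dataset 𝒳 n × (𝒳 → ℝ)) 𝒳) : Kernel (Dataset 𝒳 n) 𝒳 :=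
  (posterior ρ ⊗ₖ sel).snd

/-- One iteration: the next input `x` is drawn given the dataset only (so it is independent of `f`
given the dataset), then `f(x) + ε` is observed with a fresh noise `ε ∼ N(0, σ²)`. -/
def stepLaw (σ : ℝ) {n : ℕ} (ρ : Measure (Dataset 𝒳 n × (𝒳 → ℝ))) [IsFiniteMeasure ρ]
    (sel : Kernel (Dataset 𝒳 n × (𝒳 → ℝ)) 𝒳) : Measure (Dataset 𝒳 (n + 1) × (𝒳 → ℝ)) :=
  ((ρ ⊗ₘ (queryKernel ρ sel).comap Prod.fst measurable_fst).prod (noiseLaw σ)).map extend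

instance (σ : ℝ) {n : ℕ} (ρ : Measure (Dataset 𝒳 n × (𝒳 → ℝ))) [IsProbabilityMeasure ρ]
    (sel : Kernel (Dataset 𝒳 n × (𝒳 → ℝ)) 𝒳) [IsMarkovKernel sel] :
    IsProbabilityMeasure (stepLaw σ ρ sel) := by
  have : IsMarkovKernel (queryKernel ρ sel) := by
    unfold queryKernel posterior; infer_instance
  exact Measure.isProbabilityMeasure_map measurable_extend.aemeasurable

/-- The joint law, after `t` iterations, of the dataset (initial points included) and of `f`, when
iteration `t + 1` samples a path `g` from the current posterior and then draws the input from
`sel t (D, g)`. -/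
def runLaw (k : 𝒳 → 𝒳 → ℝ) (σ : ℝ) {n₀ : ℕ} (x₀ : Fin n₀ → 𝒳)
    (sel : ∀ t : ℕ, Kernel (Dataset 𝒳 (n₀ + t) × (𝒳 → ℝ)) 𝒳) [∀ t, IsMarkovKernel (sel t)] :
    (t : ℕ) → ProbabilityMeasure (Dataset 𝒳 (n₀ + t) × (𝒳 → ℝ))
  | 0 => ⟨initLaw k σ x₀, inferInstance⟩
  | t + 1 => ⟨stepLaw σ (runLaw k σ x₀ sel t : Measure (Dataset 𝒳 (n₀ + t) × (𝒳 → ℝ))) (sel t),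
      inferInstance⟩

/-- The PIMS selection rule: `sel t (D, g)` is concentrated on the minimizers over `x` of
`(g* - μ(x)) / σ(x)`. Ties may be broken in any way, possibly at random. -/
def IsPIMSRule (k : 𝒳 → 𝒳 → ℝ) (σ : ℝ) {n₀ : ℕ}
    (sel : ∀ t : ℕ, Kernel (Dataset 𝒳 (n₀ + t) × (𝒳 → ℝ)) 𝒳) : Prop :=
  ∀ (t : ℕ) (D : Dataset 𝒳 (n₀ + t)) (g : 𝒳 → ℝ),
    ∀ᵐ x ∂(sel t (D, g)), ∀ x', score k σ D g x ≤ score k σ D g x'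

/-- The Bayesian cumulative regret `BCR_T = E[∑ₜ (f(x*) - f(xₜ))]`. -/
def bcr (k : 𝒳 → 𝒳 → ℝ) (σ : ℝ) {n₀ : ℕ} (x₀ : Fin n₀ → 𝒳)
    (sel : ∀ t : ℕ, Kernel (Dataset 𝒳 (n₀ + t) × (𝒳 → ℝ)) 𝒳) [∀ t, IsMarkovKernel (sel t)]
    (T : ℕ) : ℝ :=
  ∫ p, regret p ∂(runLaw k σ x₀ sel T : Measure (Dataset 𝒳 (n₀ + T) × (𝒳 → ℝ)))

end Run

end PIMS

end

/-! Condition on the dataset `D`. The path `f` and the sample `g` then have the same law, and the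
query `x`, a function of `g` and independent randomness, is independent of `f`. Hence the expected
regret of one step is the conditional mean of `max g - μ(x)`, that is, of the minimal score times
`σ(x)`. The minimal score is at most the score of a maximizer `w` of `g`, which is the standardized
value `Z_w = (g(w) - μ(w)) / σ(w)`, one of `|𝒳|` standard Gaussian variables. So the squared
positive part of the minimal score is at most `c + ∑ excess c Z_z`, whose mean is at most `c + |𝒳|
exp(-c/2)`; the best choice `c = 2 log(|𝒳|/2)` gives `C₂`. This is `iSup_sub_postMean_le` averaged
in `integral_regret_gpKernel_le`, with the tail bound `lintegral_excess_gaussianReal_le`.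

The product of score and deviation is split by `r s ≤ (l/2) r² + s²/(2l)` with one `l` for all
steps. Summing over time and optimizing `l` at the end amounts to Cauchy-Schwarz, and leaves the sum
of the posterior variances at the queries. Since variances are at most `1`, Bernoulli's inequality
bounds each by `log(1 + σ²(x)/σ²)` up to the factor `1/log(1 + σ⁻²)`. Discarding the initial data
only increases variances, and the resulting sum of logarithms is twice a mutual information, hence
at most `2 γ_T` (`varSum_le`, `mutualInfo_obsLaw`).

The closed form of the posterior is obtained one observation at a time: a bordered inverse turns
`postMean` and `postCov` into rank-one updates, Gaussian conditioning shows that the joint law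
follows the same updates even under adaptive queries (`extendLaw_compProd_gpKernel`), and uniqueness
of disintegrations identifies `posterior`. -/

noncomputable section

namespace PIMS

/-! ### Bordered inverses and rank-one conditioning of covariances -/

section LinearAlgebra

open Matrix

/-- The value of the quadratic form of an inverse bordered matrix. -/
theorem snoc_dotProduct_inv_mulVec_snoc {n : ℕ} {A : Matrix (Fin n) (Fin n) ℝ}
    {B : Matrix (Fin (n + 1)) (Fin (n + 1)) ℝ} {c : Fin n → ℝ} {d : ℝ}
    (hA : IsUnit A.det) (hB : IsUnit B.det) (hsymm : Aᵀ = A)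
    (h₁ : ∀ i j, B (Fin.castSucc i) (Fin.castSucc j) = A i j)
    (h₂ : ∀ i, B (Fin.castSucc i) (Fin.last n) = c i)
    (h₃ : ∀ j, B (Fin.last n) (Fin.castSucc j) = c j)
    (h₄ : B (Fin.last n) (Fin.last n) = d) (he : d - c ⬝ᵥ A⁻¹ *ᵥ c ≠ 0)
    (u v : Fin n → ℝ) (u₀ v₀ : ℝ) :
    (Fin.snoc u u₀ : Fin (n + 1) → ℝ) ⬝ᵥ B⁻¹ *ᵥ (Fin.snoc v v₀ : Fin (n + 1) → ℝ) =
      u ⬝ᵥ A⁻¹ *ᵥ v + (u₀ - c ⬝ᵥ A⁻¹ *ᵥ u) * (v₀ - c ⬝ᵥ A⁻¹ *ᵥ v) / (d - c ⬝ᵥ A⁻¹ *ᵥ c) := by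
  set e := d - c ⬝ᵥ A⁻¹ *ᵥ c with he_def
  -- Block elimination in `B z = (v, v₀)`: the last coordinate of `z` is the residual of `v₀`
  -- divided by the Schur complement `e`, and `w` is the rest of `z`.
  set s := (v₀ - c ⬝ᵥ A⁻¹ *ᵥ v) / e with hs_def
  set w : Fin n → ℝ := A⁻¹ *ᵥ v - s • A⁻¹ *ᵥ c with hw
  have hcw : c ⬝ᵥ w = c ⬝ᵥ A⁻¹ *ᵥ v - s * (c ⬝ᵥ A⁻¹ *ᵥ c) := by
    simp [hw, dotProduct_sub, dotProduct_smul]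
  have hAw : A *ᵥ w = v - s • c := by
    rw [hw, mulVec_sub, mulVec_smul, mulVec_mulVec, mulVec_mulVec, mul_nonsing_inv _ hA,
      one_mulVec, one_mulVec]
  have hsol : B *ᵥ (Fin.snoc w s : Fin (n + 1) → ℝ) = (Fin.snoc v v₀ : Fin (n + 1) → ℝ) := by
    funext i
    refine Fin.lastCases ?_ (fun i ↦ ?_) i
    · have : ∑ j, c j * w j = c ⬝ᵥ w := rfl
      simp only [mulVec, dotProduct, Fin.sum_univ_castSucc, Fin.snoc_castSucc, Fin.snoc_last, h₃, h₄]
      rw [this, hcw]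
      have : s * e = v₀ - c ⬝ᵥ A⁻¹ *ᵥ v := by rw [hs_def]; field_simp
      rw [he_def] at this
      linarith
    · have : ∑ j, A i j * w j = (A *ᵥ w) i := rfl
      simp only [mulVec, dotProduct, Fin.sum_univ_castSucc, Fin.snoc_castSucc, Fin.snoc_last, h₁, h₂]
      rw [this, hAw]
      simp only [Pi.sub_apply, Pi.smul_apply, smul_eq_mul]
      ring
  have hinv : B⁻¹ *ᵥ (Fin.snoc v v₀ : Fin (n + 1) → ℝ) = (Fin.snoc w s : Fin (n + 1) → ℝ) := by
    rw [← hsol, mulVec_mulVec, nonsing_inv_mul _ hB, one_mulVec]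
  have hsw : u ⬝ᵥ A⁻¹ *ᵥ c = c ⬝ᵥ A⁻¹ *ᵥ u := by
    rw [dotProduct_mulVec, ← mulVec_transpose, transpose_nonsing_inv, hsymm, dotProduct_comm]
  have hsum : (Fin.snoc u u₀ : Fin (n + 1) → ℝ) ⬝ᵥ (Fin.snoc w s : Fin (n + 1) → ℝ) =
      u ⬝ᵥ w + u₀ * s := by
    simp [dotProduct, Fin.sum_univ_castSucc]
  rw [hinv, hsum, hw, dotProduct_sub, dotProduct_smul, hsw, hs_def, smul_eq_mul]
  ring

variable {𝒳 : Type*}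

/-- The covariance of a centred Gaussian vector with covariance `S` after the coordinate `x` is
observed with an independent noise of variance `s`. -/
def condCov (S : 𝒳 → 𝒳 → ℝ) (s : ℝ) (x u v : 𝒳) : ℝ := S u v - S x u * S x v / (S x x + s)

/-- The posterior covariance `k(u, v) - k(u)ᵀ (K + σ² I)⁻¹ k(v)`. -/
def postCov (k : 𝒳 → 𝒳 → ℝ) (σ : ℝ) {n : ℕ} (D : Dataset 𝒳 n) (u v : 𝒳) : ℝ :=
  k u v - kvec k D u ⬝ᵥ (regGram k σ D)⁻¹ *ᵥ kvec k D v

theorem condCov_symm {S : 𝒳 → 𝒳 → ℝ} (hS : ∀ u v, S u v = S v u) (s : ℝ) (x u v : 𝒳) :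
    condCov S s x u v = condCov S s x v u := by
  simp only [condCov, hS u v, mul_comm]

section Fintype

variable [Fintype 𝒳]

/-- The quadratic form of a function of two variables. -/
def quadForm (S : 𝒳 → 𝒳 → ℝ) (c : 𝒳 → ℝ) : ℝ := ∑ u, ∑ v, c u * S u v * c v

theorem quadForm_eq_dotProduct (S : 𝒳 → 𝒳 → ℝ) (c : 𝒳 → ℝ) :
    quadForm S c = c ⬝ᵥ Matrix.of S *ᵥ c := by
  simp [quadForm, dotProduct, mulVec, Finset.mul_sum, mul_assoc]

theorem posSemidef_of_iff {S : 𝒳 → 𝒳 → ℝ} :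
    (Matrix.of S).PosSemidef ↔ (∀ u v, S u v = S v u) ∧ ∀ c, 0 ≤ quadForm S c := by
  rw [posSemidef_iff_dotProduct_mulVec]
  simp only [quadForm_eq_dotProduct, star_trivial]
  refine and_congr_left fun _ ↦ ?_
  rw [IsHermitian.ext_iff]
  simp [eq_comm]

theorem quadForm_condCov (S : 𝒳 → 𝒳 → ℝ) (s : ℝ) (x : 𝒳) (c : 𝒳 → ℝ) :
    quadForm (condCov S s x) c = quadForm S c - (∑ u, S x u * c u) ^ 2 / (S x x + s) := by
  have h1 (u v : 𝒳) : c u * condCov S s x u v * c v =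
      c u * S u v * c v - (S x u * c u) * (S x v * c v) / (S x x + s) := by
    simp only [condCov]; ring
  simp only [quadForm, h1, Finset.sum_sub_distrib]
  rw [sq, Finset.sum_mul_sum, Finset.sum_div]
  simp only [Finset.sum_div]

variable [DecidableEq 𝒳]

theorem quadForm_sub_smul_single {S : 𝒳 → 𝒳 → ℝ} (hS : ∀ u v, S u v = S v u) (c : 𝒳 → ℝ)
    (t : ℝ) (x : 𝒳) :
    quadForm S (c - t • (Pi.single x 1 : 𝒳 → ℝ)) =
      quadForm S c - 2 * t * (∑ u, S x u * c u) + t ^ 2 * S x x := by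
  have h1 (u v : 𝒳) : (c - t • (Pi.single x 1 : 𝒳 → ℝ)) u * S u v * (c - t • (Pi.single x 1 : 𝒳 → ℝ)) v =
      c u * S u v * c v - t * (c u * S u v * (Pi.single x 1 : 𝒳 → ℝ) v)
        - t * ((Pi.single x 1 : 𝒳 → ℝ) u * (S u v * c v))
        + t ^ 2 * ((Pi.single x 1 : 𝒳 → ℝ) u * (S u v * (Pi.single x 1 : 𝒳 → ℝ) v)) := by
    simp only [Pi.sub_apply, Pi.smul_apply, smul_eq_mul]; ring
  simp only [quadForm, h1, Finset.sum_add_distrib, Finset.sum_sub_distrib, ← Finset.mul_sum]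
  simp only [Pi.single_apply, mul_ite, mul_one, mul_zero, Finset.sum_ite_eq', Finset.mem_univ,
    if_true, ite_mul, one_mul, zero_mul]
  have h2 : ∑ u, c u * S u x = ∑ u, S x u * c u :=
    Finset.sum_congr rfl fun u _ ↦ by rw [hS u x, mul_comm]
  rw [h2]; ring

/-- Best linear prediction: the right side is the variance of the error when `∑ c u * w u` is
predicted by `t` times the noisy observation at `x`, and conditioning minimizes it over `t`. The
next lemma exhibits the optimal `t`. This variational form makes positivity and monotonicity of
conditioning immediate. -/
theorem quadForm_condCov_le {S : 𝒳 → 𝒳 → ℝ} (hS : ∀ u v, S u v = S v u) {s : ℝ} {x : 𝒳}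
    (hx : 0 < S x x + s) (c : 𝒳 → ℝ) (t : ℝ) :
    quadForm (condCov S s x) c ≤ quadForm S (c - t • Pi.single x 1) + s * t ^ 2 := by
  rw [quadForm_condCov, quadForm_sub_smul_single hS]
  set b := ∑ u, S x u * c u
  have h : 0 ≤ (b - t * (S x x + s)) ^ 2 / (S x x + s) := by positivity
  have h2 : (b - t * (S x x + s)) ^ 2 / (S x x + s) =
      b ^ 2 / (S x x + s) - 2 * t * b + t ^ 2 * (S x x + s) := by
    field_simp
    ring
  linarith

theorem quadForm_condCov_eq {S : 𝒳 → 𝒳 → ℝ} (hS : ∀ u v, S u v = S v u) {s : ℝ} {x : 𝒳}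
    (hx : 0 < S x x + s) (c : 𝒳 → ℝ) :
    quadForm (condCov S s x) c =
      quadForm S (c - ((∑ u, S x u * c u) / (S x x + s)) • Pi.single x 1) +
        s * ((∑ u, S x u * c u) / (S x x + s)) ^ 2 := by
  rw [quadForm_condCov, quadForm_sub_smul_single hS]
  field_simp
  ring

theorem quadForm_single (S : 𝒳 → 𝒳 → ℝ) (x : 𝒳) : quadForm S (Pi.single x 1) = S x x := by
  simp [quadForm, Pi.single_apply]

end Fintype

variable [Fintype 𝒳] {S R : 𝒳 → 𝒳 → ℝ} {s : ℝ}

theorem apply_self_nonneg (hS : (Matrix.of S).PosSemidef) (x : 𝒳) : 0 ≤ S x x := by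
  classical
  rw [← quadForm_single S]
  exact (posSemidef_of_iff.1 hS).2 _

theorem posSemidef_condCov (hS : (Matrix.of S).PosSemidef) (hs : 0 < s) (x : 𝒳) :
    (Matrix.of (condCov S s x)).PosSemidef := by
  classical
  have hx := apply_self_nonneg hS x
  rw [posSemidef_of_iff] at hS ⊢
  refine ⟨fun u v ↦ condCov_symm hS.1 s x u v, fun c ↦ ?_⟩
  rw [quadForm_condCov_eq hS.1 (by positivity)]
  have := hS.2 (c - ((∑ u, S x u * c u) / (S x x + s)) • Pi.single x 1)
  positivity

/-- Either `S x u = 0` and the observation leaves the variance at `u` unchanged, or the optimal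
coefficient is nonzero and the noise alone contributes a positive error. -/
theorem condCov_self_pos (hS : (Matrix.of S).PosSemidef) (hs : 0 < s) (x u : 𝒳)
    (hu : 0 < S u u) : 0 < condCov S s x u u := by
  classical
  have hx := apply_self_nonneg hS x
  rw [posSemidef_of_iff] at hS
  have h := quadForm_condCov_eq hS.1 (s := s) (x := x) (by positivity) (Pi.single u 1)
  have h2 := hS.2 (Pi.single u 1 - ((∑ v, S x v * (Pi.single u 1 : 𝒳 → ℝ) v) / (S x x + s)) •
    Pi.single x 1)
  rw [quadForm_single] at h
  have hsum : ∑ v, S x v * (Pi.single u 1 : 𝒳 → ℝ) v = S x u := by simp [Pi.single_apply]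
  rw [hsum] at h h2
  rcases eq_or_ne (S x u) 0 with h0 | h0
  · simp [condCov, h0, hu]
  · rw [h]
    positivity

theorem condCov_self_le (hS : (Matrix.of S).PosSemidef) (hs : 0 < s) (x u : 𝒳) :
    condCov S s x u u ≤ S u u := by
  have hx := apply_self_nonneg hS x
  have : 0 ≤ S x u * S x u / (S x x + s) := div_nonneg (mul_self_nonneg _) (by positivity)
  simp only [condCov]
  linarith

/-- A predictor optimal for `R` is admissible for `S`, and its error under `S` is no larger. -/
theorem quadForm_condCov_mono (hS : (Matrix.of S).PosSemidef) (hR : (Matrix.of R).PosSemidef)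
    (hs : 0 < s) (h : ∀ c, quadForm S c ≤ quadForm R c) (x : 𝒳) (c : 𝒳 → ℝ) :
    quadForm (condCov S s x) c ≤ quadForm (condCov R s x) c := by
  classical
  have hx := apply_self_nonneg hS x
  have hx' := apply_self_nonneg hR x
  rw [posSemidef_of_iff] at hS hR
  rw [quadForm_condCov_eq hR.1 (by positivity)]
  refine (quadForm_condCov_le hS.1 (by positivity) c
    ((∑ u, R x u * c u) / (R x x + s))).trans ?_
  gcongr
  exact h _

end LinearAlgebra

/-! ### One-point recursion for the posterior mean and covariance -/

section PosteriorRecursion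

open Matrix

variable {𝒳 : Type*} {k : 𝒳 → 𝒳 → ℝ} {σ : ℝ} {n : ℕ}

theorem posDef_regGram (hk : (Matrix.of k).PosSemidef) (hσ : 0 < σ) (D : Dataset 𝒳 n) :
    (regGram k σ D).PosDef := by
  have h1 : (Matrix.of fun i j ↦ k (D i).1 (D j).1).PosSemidef :=
    hk.submatrix (fun i ↦ (D i).1)
  exact PosDef.posSemidef_add h1 (PosDef.one.smul (by positivity))

theorem kvec_snoc (D : Dataset 𝒳 n) (x : 𝒳) (y : ℝ) (u : 𝒳) :
    kvec k (Fin.snoc D (x, y) : Dataset 𝒳 (n + 1)) u = Fin.snoc (kvec k D u) (k u x) := by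
  funext i
  refine Fin.lastCases ?_ (fun i ↦ ?_) i <;> simp [kvec]

theorem postCov_zero (D : Dataset 𝒳 0) : postCov k σ D = k := by
  funext u v; simp [postCov, dotProduct]

theorem postMean_zero (D : Dataset 𝒳 0) (u : 𝒳) : postMean k σ D u = 0 := by
  simp [postMean, dotProduct]

theorem postVar_eq_postCov (D : Dataset 𝒳 n) (x : 𝒳) : postVar k σ D x = postCov k σ D x x := rfl

variable [Fintype 𝒳]

/-- A new data point borders the Gram matrix, and the Schur complement is the predictive variance.
Its nonvanishing is a hypothesis here because nonnegativity of posterior variances is itself deduced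
from this update, by induction in `posSemidef_postCov`. -/
theorem regGram_snoc_dotProduct (hk : (Matrix.of k).PosSemidef) (hσ : 0 < σ) (D : Dataset 𝒳 n)
    (x : 𝒳) (y : ℝ) (he : postCov k σ D x x + σ ^ 2 ≠ 0) (u v : Fin n → ℝ) (u₀ v₀ : ℝ) :
    (Fin.snoc u u₀ : Fin (n + 1) → ℝ) ⬝ᵥ (regGram k σ (Fin.snoc D (x, y) : Dataset 𝒳 (n + 1)))⁻¹ *ᵥ
        (Fin.snoc v v₀ : Fin (n + 1) → ℝ) =
      u ⬝ᵥ (regGram k σ D)⁻¹ *ᵥ v +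
        (u₀ - kvec k D x ⬝ᵥ (regGram k σ D)⁻¹ *ᵥ u) * (v₀ - kvec k D x ⬝ᵥ (regGram k σ D)⁻¹ *ᵥ v) /
          (postCov k σ D x x + σ ^ 2) := by
  have hsym := (posSemidef_of_iff.1 hk).1
  have hd : postCov k σ D x x + σ ^ 2 =
      (k x x + σ ^ 2) - kvec k D x ⬝ᵥ (regGram k σ D)⁻¹ *ᵥ kvec k D x := by
    simp only [postCov]; ring
  rw [hd] at he ⊢
  refine snoc_dotProduct_inv_mulVec_snoc (posDef_regGram hk hσ D).det_pos.ne'.isUnit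
    (posDef_regGram hk hσ _).det_pos.ne'.isUnit ?_ ?_ ?_ ?_ ?_ he u v u₀ v₀
  · have := (posDef_regGram hk hσ D).isHermitian
    rwa [IsHermitian, conjTranspose_eq_transpose_of_trivial] at this
  · intro i j
    simp [regGram, Matrix.one_apply]
  · intro i
    simp [regGram, kvec, hsym x, (Fin.castSucc_lt_last i).ne]
  · intro i
    simp [regGram, kvec, (Fin.castSucc_lt_last i).ne']
  · simp [regGram]

theorem postCov_snoc_of_ne (hk : (Matrix.of k).PosSemidef) (hσ : 0 < σ) (D : Dataset 𝒳 n)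
    (x : 𝒳) (y : ℝ) (he : postCov k σ D x x + σ ^ 2 ≠ 0) :
    postCov k σ (Fin.snoc D (x, y) : Dataset 𝒳 (n + 1)) = condCov (postCov k σ D) (σ ^ 2) x := by
  funext u v
  have hsym := (posSemidef_of_iff.1 hk).1
  rw [postCov, kvec_snoc, kvec_snoc, regGram_snoc_dotProduct hk hσ D x y he, condCov, hsym u x,
    hsym v x]
  simp only [postCov]
  ring

theorem posSemidef_postCov (hk : (Matrix.of k).PosSemidef) (hσ : 0 < σ) (D : Dataset 𝒳 n) :
    (Matrix.of (postCov k σ D)).PosSemidef := by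
  induction n with
  | zero =>
    have : postCov k σ D = k := by funext u v; simp [postCov, dotProduct]
    rwa [this]
  | succ n ih =>
    rw [← Fin.snoc_init_self (α := fun _ ↦ 𝒳 × ℝ) D]
    set x := (D (Fin.last n)).1
    have hx := apply_self_nonneg (ih (Fin.init D)) x
    have he : postCov k σ (Fin.init D : Dataset 𝒳 n) x x + σ ^ 2 ≠ 0 := by positivity
    have := postCov_snoc_of_ne hk hσ (Fin.init D) x (D (Fin.last n)).2 he
    rw [Prod.mk.eta] at this
    rw [this]
    exact posSemidef_condCov (ih _) (by positivity) _

theorem postCov_self_add_pos (hk : (Matrix.of k).PosSemidef) (hσ : 0 < σ) (D : Dataset 𝒳 n)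
    (x : 𝒳) : 0 < postCov k σ D x x + σ ^ 2 := by
  have := apply_self_nonneg (posSemidef_postCov hk hσ D) x
  positivity

theorem postCov_snoc (hk : (Matrix.of k).PosSemidef) (hσ : 0 < σ) (D : Dataset 𝒳 n)
    (x : 𝒳) (y : ℝ) :
    postCov k σ (Fin.snoc D (x, y) : Dataset 𝒳 (n + 1)) = condCov (postCov k σ D) (σ ^ 2) x :=
  postCov_snoc_of_ne hk hσ D x y (postCov_self_add_pos hk hσ D x).ne'

theorem postMean_snoc (hk : (Matrix.of k).PosSemidef) (hσ : 0 < σ) (D : Dataset 𝒳 n)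
    (x : 𝒳) (y : ℝ) (u : 𝒳) :
    postMean k σ (Fin.snoc D (x, y) : Dataset 𝒳 (n + 1)) u =
      postMean k σ D u + postCov k σ D x u / (postCov k σ D x x + σ ^ 2) *
        (y - postMean k σ D x) := by
  have hy : (fun i ↦ ((Fin.snoc D (x, y) : Dataset 𝒳 (n + 1)) i).2) =
      (Fin.snoc (fun i ↦ (D i).2) y : Fin (n + 1) → ℝ) := by
    funext i
    refine Fin.lastCases ?_ (fun i ↦ ?_) i <;> simp
  rw [postMean, hy, kvec_snoc, regGram_snoc_dotProduct hk hσ D x y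
    (postCov_self_add_pos hk hσ D x).ne', (posSemidef_of_iff.1 hk).1 u x]
  simp only [postMean, postCov]
  ring

/-- Noisy observations never determine a value exactly. Thus the score never divides by zero, where
its value would be the default `0`. -/
theorem postVar_pos (hk : (Matrix.of k).PosSemidef) (hk1 : ∀ x, k x x = 1) (hσ : 0 < σ)
    (D : Dataset 𝒳 n) (u : 𝒳) : 0 < postVar k σ D u := by
  rw [postVar_eq_postCov]
  induction n with
  | zero => simp [postCov_zero, hk1]
  | succ n ih =>
    rw [← Fin.snoc_init_self (α := fun _ ↦ 𝒳 × ℝ) D, ← Prod.mk.eta (p := D (Fin.last n)),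
      postCov_snoc hk hσ]
    exact condCov_self_pos (posSemidef_postCov hk hσ _) (by positivity) _ _ (ih _)

theorem postVar_le_one (hk : (Matrix.of k).PosSemidef) (hk1 : ∀ x, k x x = 1) (hσ : 0 < σ)
    (D : Dataset 𝒳 n) (u : 𝒳) : postVar k σ D u ≤ 1 := by
  rw [postVar_eq_postCov]
  induction n with
  | zero => simp [postCov_zero, hk1]
  | succ n ih =>
    rw [← Fin.snoc_init_self (α := fun _ ↦ 𝒳 × ℝ) D, ← Prod.mk.eta (p := D (Fin.last n)),
      postCov_snoc hk hσ]
    exact (condCov_self_le (posSemidef_postCov hk hσ _) (by positivity) _ _).trans (ih _)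

end PosteriorRecursion

/-! ### Gaussian conditioning on one noisy coordinate -/

section Gaussian

variable {𝒳 : Type*} [Fintype 𝒳] {S : 𝒳 → 𝒳 → ℝ} {σ : ℝ}

open Complex in
theorem integral_cexp_gpLaw (hS : (Matrix.of S).PosSemidef) (c : 𝒳 → ℝ) :
    ∫ w, cexp ((∑ u, c u * w u : ℝ) * I) ∂gpLaw S = cexp (-(quadForm S c : ℝ) / 2) := by
  classical
  have h := charFun_multivariateGaussian (μ := 0) hS (WithLp.toLp 2 c)
  rw [charFun_apply] at h
  rw [gpLaw, integral_map (Measurable.aemeasurable (by fun_prop))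
    (Continuous.aestronglyMeasurable (by fun_prop)), quadForm_eq_dotProduct]
  convert h using 2
  · congr
  · simp [neg_div]

open Complex in
theorem integral_cexp_gaussianReal (v : NNReal) (a : ℝ) :
    ∫ y, cexp ((a * y : ℝ) * I) ∂gaussianReal 0 v = cexp (-(v * a ^ 2 : ℝ) / 2) := by
  have h := charFun_gaussianReal (μ := 0) (v := v) a
  rw [charFun_apply_real] at h
  simpa [neg_div] using h

open Complex in
theorem Measure_prod_ext_of_integral_cexp {μ ν : Measure (ℝ × (𝒳 → ℝ))} [IsFiniteMeasure μ]
    [IsFiniteMeasure ν]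
    (h : ∀ (a : ℝ) (c : 𝒳 → ℝ), ∫ p, cexp ((a * p.1 + ∑ u, c u * p.2 u : ℝ) * I) ∂μ =
      ∫ p, cexp ((a * p.1 + ∑ u, c u * p.2 u : ℝ) * I) ∂ν) : μ = ν := by
  classical
  refine Measure.ext_of_charFunDual (funext fun L ↦ ?_)
  have hL (p : ℝ × (𝒳 → ℝ)) :
      L p = L (1, 0) * p.1 + ∑ u, L (0, Pi.single u 1) * p.2 u := by
    have hp : p = p.1 • ((1 : ℝ), (0 : 𝒳 → ℝ)) +
        ∑ u, p.2 u • ((0 : ℝ), (Pi.single u 1 : 𝒳 → ℝ)) := by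
      refine Prod.ext (by simp [Prod.fst_sum]) ?_
      funext v
      simp [Prod.snd_sum, Finset.sum_apply, Pi.single_apply]
    conv_lhs => rw [hp]
    simp only [map_add, map_sum, map_smul, smul_eq_mul, mul_comm]
  rw [charFunDual_apply, charFunDual_apply]
  simp_rw [fun p ↦ congrArg ((↑) : ℝ → ℂ) (hL p)]
  exact h _ _

/-- Gaussian conditioning: a centred Gaussian vector and a noisy observation of one of its
coordinates, as the noisy observation and an independent residual. -/
theorem map_gpLaw_prod_noiseLaw (hS : (Matrix.of S).PosSemidef) (hσ : 0 < σ) (x : 𝒳) :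
    ((gpLaw S).prod (noiseLaw σ)).map (fun p ↦ (p.1 x + p.2, p.1)) =
      ((gaussianReal 0 (Real.toNNReal (S x x + σ ^ 2))).prod (gpLaw (condCov S (σ ^ 2) x))).map
        (fun p ↦ (p.1, fun u ↦ p.2 u + S x u / (S x x + σ ^ 2) * p.1)) := by
  classical
  have hx := apply_self_nonneg hS x
  have hpos : 0 < S x x + σ ^ 2 := by positivity
  have hm1 : Measurable (fun p : (𝒳 → ℝ) × ℝ ↦ (p.1 x + p.2, p.1)) := by fun_prop
  have hm2 : Measurable (fun p : ℝ × (𝒳 → ℝ) ↦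
      (p.1, fun u ↦ p.2 u + S x u / (S x x + σ ^ 2) * p.1)) := by fun_prop
  have := Measure.isProbabilityMeasure_map (μ := (gpLaw S).prod (noiseLaw σ)) hm1.aemeasurable
  have := Measure.isProbabilityMeasure_map (μ := (gaussianReal 0 (Real.toNNReal (S x x + σ ^ 2))).prod
    (gpLaw (condCov S (σ ^ 2) x))) hm2.aemeasurable
  refine Measure_prod_ext_of_integral_cexp fun a c ↦ ?_
  rw [integral_map hm1.aemeasurable (Continuous.aestronglyMeasurable (by fun_prop)),
    integral_map hm2.aemeasurable (Continuous.aestronglyMeasurable (by fun_prop))]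
  -- The observed coordinate adds `a` to the coefficient of `x`; the double sign matches
  -- `quadForm_sub_smul_single`.
  have h1 (p : (𝒳 → ℝ) × ℝ) :
      Complex.exp ((a * (p.1 x + p.2) + ∑ u, c u * p.1 u : ℝ) * Complex.I) =
      Complex.exp ((∑ u, (c - (-a) • (Pi.single x 1 : 𝒳 → ℝ)) u * p.1 u : ℝ) * Complex.I) *
        Complex.exp ((a * p.2 : ℝ) * Complex.I) := by
    rw [← Complex.exp_add, ← add_mul, ← Complex.ofReal_add]
    congr 3
    simp [add_mul, Finset.sum_add_distrib, Pi.single_apply]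
    ring
  set β := ∑ u, S x u * c u with hβ
  have h2 (p : ℝ × (𝒳 → ℝ)) :
      Complex.exp ((a * p.1 + ∑ u, c u * (p.2 u + S x u / (S x x + σ ^ 2) * p.1) : ℝ) * Complex.I) =
      Complex.exp (((a + β / (S x x + σ ^ 2)) * p.1 : ℝ) * Complex.I) *
        Complex.exp ((∑ u, c u * p.2 u : ℝ) * Complex.I) := by
    rw [← Complex.exp_add, ← add_mul, ← Complex.ofReal_add]
    congr 3
    simp only [mul_add, Finset.sum_add_distrib, add_mul, hβ, Finset.sum_div, Finset.sum_mul]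
    have : ∑ u, c u * (S x u / (S x x + σ ^ 2) * p.1) =
      ∑ u, S x u * c u / (S x x + σ ^ 2) * p.1 := Finset.sum_congr rfl fun u _ ↦ by ring
    rw [this]; ring
  simp only [h1, h2]
  rw [integral_prod_mul (fun w : 𝒳 → ℝ ↦ Complex.exp ((∑ u,
      (c - (-a) • (Pi.single x 1 : 𝒳 → ℝ)) u * w u : ℝ) * Complex.I))
      (fun e : ℝ ↦ Complex.exp ((a * e : ℝ) * Complex.I)),
    integral_prod_mul (fun e : ℝ ↦ Complex.exp (((a + β / (S x x + σ ^ 2)) * e : ℝ) * Complex.I))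
      (fun w : 𝒳 → ℝ ↦ Complex.exp ((∑ u, c u * w u : ℝ) * Complex.I)),
    integral_cexp_gpLaw hS, integral_cexp_gpLaw (posSemidef_condCov hS (by positivity) x), noiseLaw,
    integral_cexp_gaussianReal, integral_cexp_gaussianReal, ← Complex.exp_add, ← Complex.exp_add,
    quadForm_sub_smul_single (posSemidef_of_iff.1 hS).1, quadForm_condCov,
    Real.coe_toNNReal _ (by positivity), Real.coe_toNNReal _ (by positivity), ← hβ]
  -- Completing the square: with `τ = S x x + σ ^ 2` and `Q` the form of `S`, `Q(c) + 2aβ + a²τ =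
  -- τ(a + β/τ)² + (Q(c) - β²/τ)`.
  congr 1
  have : (S x x + σ ^ 2 : ℂ) ≠ 0 := by exact_mod_cast hpos.ne'
  push_cast
  field_simp
  ring

theorem gpLaw_map_eval (hS : (Matrix.of S).PosSemidef) (x : 𝒳) :
    (gpLaw S).map (fun w ↦ w x) = gaussianReal 0 (Real.toNNReal (S x x)) := by
  classical
  rw [gpLaw, Measure.map_map (by fun_prop) (by fun_prop)]
  have h := (measurePreserving_eval_multivariateGaussian (μ := 0) hS (i := x)).map_eq
  convert h using 2
  · congr
  · simp
  · rfl

theorem lintegral_gpLaw_prod_noiseLaw (hS : (Matrix.of S).PosSemidef) (hσ : 0 < σ) (x : 𝒳)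
    {φ : ℝ × (𝒳 → ℝ) → ℝ≥0∞} (hφ : Measurable φ) :
    ∫⁻ w, ∫⁻ e, φ (w x + e, w) ∂noiseLaw σ ∂gpLaw S =
      ∫⁻ y, ∫⁻ w, φ (y, fun u ↦ w u + S x u / (S x x + σ ^ 2) * y) ∂gpLaw (condCov S (σ ^ 2) x)
        ∂gaussianReal 0 (Real.toNNReal (S x x + σ ^ 2)) := by
  have h := congrArg (fun μ ↦ ∫⁻ p, φ p ∂μ) (map_gpLaw_prod_noiseLaw hS hσ x)
  rw [lintegral_map hφ (by fun_prop), lintegral_map hφ (by fun_prop),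
    lintegral_prod _ (Measurable.aemeasurable (by fun_prop)),
    lintegral_prod _ (Measurable.aemeasurable (by fun_prop))] at h
  exact h

end Gaussian

/-! ### The Gaussian posterior kernel and the law of an adaptive run -/

section Kernels

variable {𝒳 : Type*} [Fintype 𝒳] [MeasurableSpace 𝒳] [MeasurableSingletonClass 𝒳] {n : ℕ}

/-- Input tuples range over a finite discrete space, so every function of them is measurable. The
posterior covariance and the Gram matrix depend on the inputs only, hence the placeholder
observations `0` below. -/
theorem measurable_comp_inputs {β : Type*} [MeasurableSpace β] (F : (Fin n → 𝒳) → β) :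
    Measurable (fun D : Dataset 𝒳 n ↦ F (fun i ↦ (D i).1)) :=
  (Measurable.of_discrete (f := F)).comp (by fun_prop)

theorem measurable_postMean (k : 𝒳 → 𝒳 → ℝ) (σ : ℝ) (u : 𝒳) :
    Measurable (fun D : Dataset 𝒳 n ↦ postMean k σ D u) := by
  simp only [postMean, dotProduct, Matrix.mulVec]
  refine Finset.measurable_sum _ fun i _ ↦ Measurable.mul ?_
    (Finset.measurable_sum _ fun j _ ↦ Measurable.mul ?_ (by fun_prop))
  · exact measurable_comp_inputs (fun xs ↦ k u (xs i))
  · exact measurable_comp_inputs (fun xs ↦ (regGram k σ (fun i ↦ (xs i, 0)))⁻¹ i j)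

theorem measurable_postCov (k : 𝒳 → 𝒳 → ℝ) (σ : ℝ) (u v : 𝒳) :
    Measurable (fun D : Dataset 𝒳 n ↦ postCov k σ D u v) :=
  measurable_comp_inputs (fun xs ↦ postCov k σ (fun i ↦ (xs i, 0)) u v)

theorem measurable_postMean_uncurry (k : 𝒳 → 𝒳 → ℝ) (σ : ℝ) :
    Measurable (fun p : Dataset 𝒳 n × 𝒳 ↦ postMean k σ p.1 p.2) :=
  measurable_from_prod_countable_left fun u ↦ measurable_postMean k σ u

theorem measurable_postCov_self_uncurry (k : 𝒳 → 𝒳 → ℝ) (σ : ℝ) :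
    Measurable (fun p : Dataset 𝒳 n × 𝒳 ↦ postCov k σ p.1 p.2 p.2) :=
  measurable_from_prod_countable_left fun u ↦ measurable_postCov k σ u u

omit [Fintype 𝒳] [MeasurableSingletonClass 𝒳] in
theorem measurable_snoc :
    Measurable (fun p : (Dataset 𝒳 n × 𝒳) × ℝ ↦
      (Fin.snoc p.1.1 (p.1.2, p.2) : Dataset 𝒳 (n + 1))) := by
  refine measurable_pi_lambda _ fun i ↦ Fin.lastCases ?_ (fun j ↦ ?_) i
  · simp only [Fin.snoc_last]; fun_prop
  · simp only [Fin.snoc_castSucc]; fun_prop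

theorem measurable_eval_uncurry : Measurable (fun q : (𝒳 → ℝ) × 𝒳 ↦ q.1 q.2) :=
  measurable_from_prod_countable_left fun x ↦ measurable_pi_apply x

/-- The Gaussian law with the posterior mean and the posterior covariance of a dataset. -/
def gpKernel (k : 𝒳 → 𝒳 → ℝ) (σ : ℝ) (n : ℕ) : Kernel (Dataset 𝒳 n) (𝒳 → ℝ) :=
  (Kernel.id ×ₖ (Kernel.ofFunOfCountable
    (fun xs : Fin n → 𝒳 ↦ gpLaw (postCov k σ (fun i ↦ (xs i, 0))))).comap
      (fun D : Dataset 𝒳 n ↦ fun i ↦ (D i).1) (by fun_prop)).map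
    (fun p u ↦ postMean k σ p.1 u + p.2 u)

theorem measurable_postMean_add (k : 𝒳 → 𝒳 → ℝ) (σ : ℝ) :
    Measurable (fun (p : Dataset 𝒳 n × (𝒳 → ℝ)) u ↦ postMean k σ p.1 u + p.2 u) :=
  measurable_pi_lambda _ fun u ↦ ((measurable_postMean k σ u).comp measurable_fst).add
    ((measurable_pi_apply u).comp measurable_snd)

instance (k : 𝒳 → 𝒳 → ℝ) (σ : ℝ) : IsMarkovKernel (gpKernel k σ n) := by
  have : IsMarkovKernel (Kernel.ofFunOfCountable
      (fun xs : Fin n → 𝒳 ↦ gpLaw (postCov k σ (fun i ↦ (xs i, 0))))) :=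
    ⟨fun _ ↦ inferInstanceAs (IsProbabilityMeasure (gpLaw _))⟩
  exact Kernel.IsMarkovKernel.map _ (measurable_postMean_add k σ)

theorem gpKernel_apply (k : 𝒳 → 𝒳 → ℝ) (σ : ℝ) (D : Dataset 𝒳 n) :
    gpKernel k σ n D = (gpLaw (postCov k σ D)).map (fun w u ↦ postMean k σ D u + w u) := by
  have : IsMarkovKernel (Kernel.ofFunOfCountable
      (fun xs : Fin n → 𝒳 ↦ gpLaw (postCov k σ (fun i ↦ (xs i, 0))))) :=
    ⟨fun _ ↦ inferInstanceAs (IsProbabilityMeasure (gpLaw _))⟩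
  rw [gpKernel, Kernel.map_apply _ (measurable_postMean_add k σ), Kernel.prod_apply,
    Kernel.id_apply, Kernel.comap_apply, Measure.dirac_prod,
    Measure.map_map (measurable_postMean_add k σ) (by fun_prop)]
  rfl

/-- The predictive law `N(μ(x), σ²(x) + σ²)` of an observation at `x` given a dataset. -/
def predKernel (k : 𝒳 → 𝒳 → ℝ) (σ : ℝ) (n : ℕ) : Kernel (Dataset 𝒳 n × 𝒳) ℝ where
  toFun p := gaussianReal (postMean k σ p.1 p.2) (Real.toNNReal (postCov k σ p.1 p.2 p.2 + σ ^ 2))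
  measurable' := measurable_gaussianReal.comp ((measurable_postMean_uncurry k σ).prodMk
    ((measurable_postCov_self_uncurry k σ).add_const _).real_toNNReal)

theorem predKernel_apply (k : 𝒳 → 𝒳 → ℝ) (σ : ℝ) (D : Dataset 𝒳 n) (x : 𝒳) :
    predKernel k σ n (D, x) =
      gaussianReal (postMean k σ D x) (Real.toNNReal (postCov k σ D x x + σ ^ 2)) := rfl

instance (k : 𝒳 → 𝒳 → ℝ) (σ : ℝ) : IsMarkovKernel (predKernel k σ n) :=
  ⟨fun _ ↦ inferInstanceAs (IsProbabilityMeasure (gaussianReal _ _))⟩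

/-- The law of a dataset extended by an input drawn from `q` and by its predicted observation. -/
def dataStep (k : 𝒳 → 𝒳 → ℝ) (σ : ℝ) (m : Measure (Dataset 𝒳 n)) (q : Kernel (Dataset 𝒳 n) 𝒳) :
    Measure (Dataset 𝒳 (n + 1)) :=
  ((m ⊗ₘ q) ⊗ₘ predKernel k σ n).map (fun p ↦ Fin.snoc p.1.1 (p.1.2, p.2))

instance (k : 𝒳 → 𝒳 → ℝ) (σ : ℝ) (m : Measure (Dataset 𝒳 n)) [IsProbabilityMeasure m]
    (q : Kernel (Dataset 𝒳 n) 𝒳) [IsMarkovKernel q] : IsProbabilityMeasure (dataStep k σ m q) :=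
  Measure.isProbabilityMeasure_map measurable_snoc.aemeasurable

/-- The joint law of a dataset and a path, after one more noisy evaluation at an input drawn from a
kernel given the dataset. -/
def extendLaw (σ : ℝ) (ρ : Measure (Dataset 𝒳 n × (𝒳 → ℝ))) (q : Kernel (Dataset 𝒳 n) 𝒳) :
    Measure (Dataset 𝒳 (n + 1) × (𝒳 → ℝ)) :=
  ((ρ ⊗ₘ q.comap Prod.fst measurable_fst).prod (noiseLaw σ)).map extend

instance (σ : ℝ) (ρ : Measure (Dataset 𝒳 n × (𝒳 → ℝ))) [IsProbabilityMeasure ρ]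
    (q : Kernel (Dataset 𝒳 n) 𝒳) [IsMarkovKernel q] : IsProbabilityMeasure (extendLaw σ ρ q) :=
  Measure.isProbabilityMeasure_map measurable_extend.aemeasurable

theorem lintegral_dataStep (k : 𝒳 → 𝒳 → ℝ) (σ : ℝ) (m : Measure (Dataset 𝒳 n)) [SFinite m]
    (q : Kernel (Dataset 𝒳 n) 𝒳) [IsMarkovKernel q] {φ : Dataset 𝒳 (n + 1) → ℝ≥0∞}
    (hφ : Measurable φ) :
    ∫⁻ D, φ D ∂dataStep k σ m q =
      ∫⁻ D, ∫⁻ x, ∫⁻ y, φ (Fin.snoc D (x, y)) ∂predKernel k σ n (D, x) ∂q D ∂m := by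
  have h : Measurable (fun p : (Dataset 𝒳 n × 𝒳) × ℝ ↦ φ (Fin.snoc p.1.1 (p.1.2, p.2))) :=
    hφ.comp measurable_snoc
  rw [dataStep, lintegral_map hφ measurable_snoc, Measure.lintegral_compProd h,
    Measure.lintegral_compProd h.lintegral_kernel_prod_right']

theorem lintegral_extendLaw (σ : ℝ) (ρ : Measure (Dataset 𝒳 n × (𝒳 → ℝ))) [SFinite ρ]
    (q : Kernel (Dataset 𝒳 n) 𝒳) [IsMarkovKernel q] {φ : Dataset 𝒳 (n + 1) × (𝒳 → ℝ) → ℝ≥0∞}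
    (hφ : Measurable φ) :
    ∫⁻ p, φ p ∂extendLaw σ ρ q =
      ∫⁻ p, ∫⁻ x, ∫⁻ e, φ (Fin.snoc p.1 (x, p.2 x + e), p.2) ∂noiseLaw σ ∂q p.1 ∂ρ := by
  have h : Measurable (fun p : ((Dataset 𝒳 n × (𝒳 → ℝ)) × 𝒳) × ℝ ↦ φ (extend p)) :=
    hφ.comp measurable_extend
  rw [extendLaw, lintegral_map hφ measurable_extend, lintegral_prod _ h.aemeasurable,
    Measure.lintegral_compProd h.lintegral_prod_right']
  rfl

theorem lintegral_gpKernel (k : 𝒳 → 𝒳 → ℝ) (σ : ℝ) (D : Dataset 𝒳 n) {φ : (𝒳 → ℝ) → ℝ≥0∞}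
    (hφ : Measurable φ) :
    ∫⁻ f, φ f ∂gpKernel k σ n D =
      ∫⁻ w, φ (fun u ↦ postMean k σ D u + w u) ∂gpLaw (postCov k σ D) := by
  rw [gpKernel_apply, lintegral_map hφ (by fun_prop)]

variable {k : 𝒳 → 𝒳 → ℝ} {σ : ℝ}

/-- The Bayesian update under adaptive queries: drawing `f` from the posterior and then a noisy
value is the same as drawing the value from its predictive law and then `f` from the updated
posterior. For fixed `D` and `x` this is Gaussian conditioning, matched with the rank-one
recursions. -/
theorem extendLaw_compProd_gpKernel (hk : (Matrix.of k).PosSemidef) (hσ : 0 < σ)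
    (m : Measure (Dataset 𝒳 n)) [SFinite m] (q : Kernel (Dataset 𝒳 n) 𝒳) [IsMarkovKernel q] :
    extendLaw σ (m ⊗ₘ gpKernel k σ n) q = dataStep k σ m q ⊗ₘ gpKernel k σ (n + 1) := by
  have : SFinite (dataStep k σ m q) := by unfold dataStep; infer_instance
  refine Measure.ext_of_lintegral _ fun φ hφ ↦ ?_
  have hm : Measurable (fun p : ((Dataset 𝒳 n × (𝒳 → ℝ)) × 𝒳) × ℝ ↦
      φ (Fin.snoc p.1.1.1 (p.1.2, p.1.1.2 p.1.2 + p.2), p.1.1.2)) := hφ.comp measurable_extend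
  have hm1 : Measurable (fun p : (Dataset 𝒳 n × (𝒳 → ℝ)) × 𝒳 ↦
      ∫⁻ e, φ (Fin.snoc p.1.1 (p.2, p.1.2 p.2 + e), p.1.2) ∂noiseLaw σ) := hm.lintegral_prod_right'
  have hm2 : Measurable (fun p : Dataset 𝒳 n × (𝒳 → ℝ) ↦
      ∫⁻ x, ∫⁻ e, φ (Fin.snoc p.1 (x, p.2 x + e), p.2) ∂noiseLaw σ ∂q p.1) :=
    hm1.lintegral_kernel_prod_right' (κ := q.comap Prod.fst measurable_fst)
  rw [lintegral_extendLaw _ _ _ hφ, Measure.lintegral_compProd hm2, Measure.lintegral_compProd hφ,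
    lintegral_dataStep _ _ _ _ hφ.lintegral_kernel_prod_right']
  refine lintegral_congr fun D ↦ ?_
  dsimp only
  -- The query law depends on `D` alone, so `x` can be drawn before `f`.
  rw [lintegral_lintegral_swap (f := fun (f : 𝒳 → ℝ) x ↦
    ∫⁻ e, φ (Fin.snoc D (x, f x + e), f) ∂noiseLaw σ) (hm1.comp
    (by fun_prop : Measurable fun p : (𝒳 → ℝ) × 𝒳 ↦ ((D, p.1), p.2))).aemeasurable]
  refine lintegral_congr fun x ↦ ?_
  have hφ2 : Measurable (fun p : ℝ × (𝒳 → ℝ) ↦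
      φ (Fin.snoc D (x, postMean k σ D x + p.1), fun u ↦ postMean k σ D u + p.2 u)) := by
    refine hφ.comp (Measurable.prodMk ?_ (by fun_prop))
    exact measurable_snoc.comp
      (by fun_prop : Measurable fun p : ℝ × (𝒳 → ℝ) ↦ ((D, x), postMean k σ D x + p.1))
  have h := lintegral_gpLaw_prod_noiseLaw (posSemidef_postCov hk hσ D) hσ x hφ2
  have hm3 : Measurable (fun f : 𝒳 → ℝ ↦
      ∫⁻ e, φ (Fin.snoc D (x, f x + e), f) ∂noiseLaw σ) :=
    hm1.comp (by fun_prop : Measurable fun f : 𝒳 → ℝ ↦ ((D, f), x))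
  rw [lintegral_gpKernel _ _ _ hm3, predKernel_apply]
  simp only [add_assoc]
  rw [h, ← zero_add (postMean k σ D x), ← gaussianReal_map_const_add, lintegral_map _ (by fun_prop)]
  · refine lintegral_congr fun y ↦ ?_
    rw [zero_add, lintegral_gpKernel _ _ _ (by fun_prop), postCov_snoc hk hσ]
    refine lintegral_congr fun w ↦ ?_
    congr 2
    funext u
    rw [postMean_snoc hk hσ]
    ring
  · exact (hφ.lintegral_kernel_prod_right' (κ := gpKernel k σ (n + 1))).comp (measurable_snoc.comp
      (by fun_prop : Measurable fun y : ℝ ↦ ((D, x), y)))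

/-- The conditional law of the path given the dataset is the Gaussian law with the posterior mean
and the posterior covariance. -/
def IsPosteriorLaw (k : 𝒳 → 𝒳 → ℝ) (σ : ℝ) (ρ : Measure (Dataset 𝒳 n × (𝒳 → ℝ))) : Prop :=
  ρ = ρ.fst ⊗ₘ gpKernel k σ n

theorem IsPosteriorLaw.fst_extendLaw (hk : (Matrix.of k).PosSemidef) (hσ : 0 < σ)
    {ρ : Measure (Dataset 𝒳 n × (𝒳 → ℝ))} [IsProbabilityMeasure ρ] (hρ : IsPosteriorLaw k σ ρ)
    (q : Kernel (Dataset 𝒳 n) 𝒳) [IsMarkovKernel q] :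
    (extendLaw σ ρ q).fst = dataStep k σ ρ.fst q := by
  conv_lhs => rw [hρ]
  rw [extendLaw_compProd_gpKernel hk hσ, Measure.fst_compProd]

theorem IsPosteriorLaw.extendLaw (hk : (Matrix.of k).PosSemidef) (hσ : 0 < σ)
    {ρ : Measure (Dataset 𝒳 n × (𝒳 → ℝ))} [IsProbabilityMeasure ρ] (hρ : IsPosteriorLaw k σ ρ)
    (q : Kernel (Dataset 𝒳 n) 𝒳) [IsMarkovKernel q] :
    IsPosteriorLaw k σ (PIMS.extendLaw σ ρ q) := by
  rw [IsPosteriorLaw, hρ.fst_extendLaw hk hσ, ← extendLaw_compProd_gpKernel hk hσ, ← hρ]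

omit [MeasurableSingletonClass 𝒳] in
theorem lintegral_initLaw (k : 𝒳 → 𝒳 → ℝ) (σ : ℝ) (x₀ : Fin n → 𝒳)
    {φ : Dataset 𝒳 n × (𝒳 → ℝ) → ℝ≥0∞} (hφ : Measurable φ) :
    ∫⁻ p, φ p ∂initLaw k σ x₀ = ∫⁻ f, ∫⁻ e, φ (fun i ↦ (x₀ i, f (x₀ i) + e i), f)
      ∂(Measure.pi fun _ ↦ noiseLaw σ) ∂gpLaw k := by
  rw [initLaw, lintegral_map hφ (measurable_observe x₀),
    lintegral_prod (fun p ↦ φ (observe x₀ p)) (hφ.comp (measurable_observe x₀)).aemeasurable]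
  rfl

/-- A fixed design is a run with deterministic queries, so the initial data fall under the same
induction as the adaptive steps. -/
theorem initLaw_succ (k : 𝒳 → 𝒳 → ℝ) (σ : ℝ) (x₀ : Fin (n + 1) → 𝒳) :
    initLaw k σ x₀ = extendLaw σ (initLaw k σ (fun i ↦ x₀ (Fin.castSucc i)))
      (Kernel.const _ (Measure.dirac (x₀ (Fin.last n)))) := by
  refine Measure.ext_of_lintegral _ fun φ hφ ↦ ?_
  have hm : Measurable (fun p : ((Dataset 𝒳 n × (𝒳 → ℝ)) × 𝒳) × ℝ ↦
      φ (Fin.snoc p.1.1.1 (p.1.2, p.1.1.2 p.1.2 + p.2), p.1.1.2)) := hφ.comp measurable_extend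
  have hm1 : Measurable (fun p : (Dataset 𝒳 n × (𝒳 → ℝ)) × 𝒳 ↦
      ∫⁻ e, φ (Fin.snoc p.1.1 (p.2, p.1.2 p.2 + e), p.1.2) ∂noiseLaw σ) := hm.lintegral_prod_right'
  rw [lintegral_extendLaw _ _ _ hφ, lintegral_initLaw _ _ _ hφ]
  have hm2 : Measurable (fun p : Dataset 𝒳 n × (𝒳 → ℝ) ↦ ∫⁻ e,
      φ (Fin.snoc p.1 (x₀ (Fin.last n), p.2 (x₀ (Fin.last n)) + e), p.2) ∂noiseLaw σ) :=
    hm1.comp (by fun_prop : Measurable fun p : Dataset 𝒳 n × (𝒳 → ℝ) ↦ (p, x₀ (Fin.last n)))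
  simp only [Kernel.const_apply, lintegral_dirac]
  rw [lintegral_initLaw _ _ _ hm2]
  refine lintegral_congr fun f ↦ ?_
  have hmp := measurePreserving_piFinSuccAbove (fun _ : Fin (n + 1) ↦ noiseLaw σ) (Fin.last n)
  rw [← hmp.symm.lintegral_comp_emb (MeasurableEquiv.measurableEmbedding _),
    lintegral_prod_symm]
  · refine lintegral_congr fun e ↦ lintegral_congr fun e' ↦ ?_
    congr 2
    funext i
    refine Fin.lastCases ?_ (fun i ↦ ?_) i
    · simp [MeasurableEquiv.piFinSuccAbove]
    · simp [MeasurableEquiv.piFinSuccAbove]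
  · refine Measurable.aemeasurable ?_
    have : Measurable (fun e : Fin (n + 1) → ℝ ↦ φ (fun i ↦ (x₀ i, f (x₀ i) + e i), f)) :=
      hφ.comp (by fun_prop)
    exact this.comp (MeasurableEquiv.measurable _)

theorem isPosteriorLaw_initLaw (hk : (Matrix.of k).PosSemidef) (hσ : 0 < σ) (x₀ : Fin n → 𝒳) :
    IsPosteriorLaw k σ (initLaw k σ x₀) := by
  induction n with
  | zero =>
    suffices h : initLaw k σ x₀ =
        (Measure.dirac (fun i ↦ i.elim0 : Dataset 𝒳 0)) ⊗ₘ gpKernel k σ 0 by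
      rw [IsPosteriorLaw]
      conv_rhs => rw [h, Measure.fst_compProd]
      exact h
    refine Measure.ext_of_lintegral _ fun φ hφ ↦ ?_
    rw [lintegral_initLaw _ _ _ hφ, Measure.lintegral_compProd hφ,
      lintegral_dirac' _ hφ.lintegral_kernel_prod_right', lintegral_gpKernel _ _ _ (by fun_prop),
      postCov_zero]
    refine lintegral_congr fun f ↦ ?_
    simp only [postMean_zero, zero_add]
    rw [Measure.pi_of_empty _ (fun i ↦ i.elim0),
      lintegral_dirac' _ (f := fun e : Fin 0 → ℝ ↦ φ (fun i ↦ (x₀ i, f (x₀ i) + e i), f))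
        (hφ.comp (by fun_prop))]
    congr 2
    exact Subsingleton.elim _ _
  | succ n ih =>
    rw [initLaw_succ]
    exact (ih _).extendLaw hk hσ _

instance (ρ : Measure (Dataset 𝒳 n × (𝒳 → ℝ))) [IsProbabilityMeasure ρ]
    (sel : Kernel (Dataset 𝒳 n × (𝒳 → ℝ)) 𝒳) [IsMarkovKernel sel] :
    IsMarkovKernel (queryKernel ρ sel) := by
  unfold queryKernel posterior; infer_instance

theorem isPosteriorLaw_runLaw (hk : (Matrix.of k).PosSemidef) (hσ : 0 < σ) {n₀ : ℕ}
    (x₀ : Fin n₀ → 𝒳) (sel : ∀ t : ℕ, Kernel (Dataset 𝒳 (n₀ + t) × (𝒳 → ℝ)) 𝒳)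
    [∀ t, IsMarkovKernel (sel t)] (t : ℕ) :
    IsPosteriorLaw k σ (runLaw k σ x₀ sel t : Measure (Dataset 𝒳 (n₀ + t) × (𝒳 → ℝ))) := by
  induction t with
  | zero => exact isPosteriorLaw_initLaw hk hσ x₀
  | succ t ih => exact ih.extendLaw hk hσ (queryKernel _ (sel t))

/-- Uniqueness of disintegrations: the abstract conditional law sampled by the algorithm is the
explicit Gaussian one. -/
theorem IsPosteriorLaw.posterior_ae_eq {ρ : Measure (Dataset 𝒳 n × (𝒳 → ℝ))}
    [IsFiniteMeasure ρ] (hρ : IsPosteriorLaw k σ ρ) :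
    ∀ᵐ D ∂ρ.fst, posterior ρ D = gpKernel k σ n D := by
  filter_upwards [eq_condKernel_of_measure_eq_compProd (gpKernel k σ n) hρ] with D hD
  exact hD.symm

end Kernels

/-! ### Gaussian likelihood ratios and Kullback-Leibler divergence -/

section GaussianRatio

/-- The log-likelihood ratio of the Gaussian laws `N(m₁, v₁)` and `N(m₂, v₂)`. -/
def gaussLogRatio (m₁ v₁ m₂ v₂ y : ℝ) : ℝ :=
  (1 / 2) * Real.log (v₂ / v₁) - (1 / 2) * ((y - m₁) ^ 2 / v₁) + (1 / 2) * ((y - m₂) ^ 2 / v₂)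

theorem lintegral_gaussianReal_eq_lintegral_exp_gaussLogRatio (m₁ m₂ : ℝ) {v₁ v₂ : ℝ}
    (h₁ : 0 < v₁) (h₂ : 0 < v₂) {φ : ℝ → ℝ≥0∞} (hφ : Measurable φ) :
    ∫⁻ y, φ y ∂gaussianReal m₁ (Real.toNNReal v₁) =
      ∫⁻ y, ENNReal.ofReal (Real.exp (gaussLogRatio m₁ v₁ m₂ v₂ y)) * φ y
        ∂gaussianReal m₂ (Real.toNNReal v₂) := by
  have hm : Measurable (fun y ↦ ENNReal.ofReal (Real.exp (gaussLogRatio m₁ v₁ m₂ v₂ y)) * φ y) := by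
    unfold gaussLogRatio; fun_prop
  rw [gaussianReal_of_var_ne_zero _ (Real.toNNReal_pos.2 h₁).ne',
    gaussianReal_of_var_ne_zero _ (Real.toNNReal_pos.2 h₂).ne',
    lintegral_withDensity_eq_lintegral_mul _ (measurable_gaussianPDF _ _) hφ,
    lintegral_withDensity_eq_lintegral_mul _ (measurable_gaussianPDF _ _) hm]
  refine lintegral_congr fun y ↦ ?_
  simp only [Pi.mul_apply]
  rw [← mul_assoc, gaussianPDF, gaussianPDF, ← ENNReal.ofReal_mul (gaussianPDFReal_nonneg _ _ _)]
  congr 2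
  simp only [gaussianPDFReal, Real.coe_toNNReal _ h₁.le, Real.coe_toNNReal _ h₂.le, gaussLogRatio]
  rw [Real.exp_add, Real.exp_sub]
  have hl : Real.exp (1 / 2 * Real.log (v₂ / v₁)) = √v₂ / √v₁ := by
    rw [← Real.sqrt_div' _ h₁.le, Real.sqrt_eq_rpow, Real.rpow_def_of_pos (by positivity), mul_comm]
  have e1 : Real.exp (-(y - m₁) ^ 2 / (2 * v₁)) = (Real.exp (1 / 2 * ((y - m₁) ^ 2 / v₁)))⁻¹ := by
    rw [← Real.exp_neg]; congr 1; field_simp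
  have e2 : Real.exp (-(y - m₂) ^ 2 / (2 * v₂)) = (Real.exp (1 / 2 * ((y - m₂) ^ 2 / v₂)))⁻¹ := by
    rw [← Real.exp_neg]; congr 1; field_simp
  rw [hl, e1, e2, Real.sqrt_mul (x := 2 * Real.pi) (by positivity) v₁,
    Real.sqrt_mul (x := 2 * Real.pi) (by positivity) v₂]
  have := Real.sqrt_pos.2 h₁
  have := Real.sqrt_pos.2 h₂
  have : 0 < √(2 * Real.pi) := by positivity
  generalize √(2 * Real.pi) = r at *
  field_simp

/-- Used for the noise law and for the predictive law: the two quadratic terms of `gaussLogRatio`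
then cancel in expectation. -/
theorem lintegral_sq_div_gaussianReal (m : ℝ) {v : ℝ} (hv : 0 < v) :
    ∫⁻ y, ENNReal.ofReal ((y - m) ^ 2 / v) ∂gaussianReal m (Real.toNNReal v) = 1 := by
  have hint : Integrable (fun y ↦ (y - m) ^ 2) (gaussianReal m (Real.toNNReal v)) :=
    ((memLp_id_gaussianReal 2).sub (memLp_const m)).integrable_sq
  rw [← ofReal_integral_eq_lintegral_ofReal (hint.div_const v)
    (Filter.Eventually.of_forall fun y ↦ by positivity), integral_div]
  have hvar := variance_id_gaussianReal (μ := m) (v := Real.toNNReal v)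
  rw [variance_eq_integral (by fun_prop)] at hvar
  simp only [id, integral_id_gaussianReal, Real.coe_toNNReal _ hv.le] at hvar
  rw [hvar, div_self hv.ne', ENNReal.ofReal_one]

theorem integrable_and_integral_eq_one {Ω : Type*} [MeasurableSpace Ω] {μ : Measure Ω} {h : Ω → ℝ}
    (hm : Measurable h) (h0 : ∀ ω, 0 ≤ h ω) (h1 : ∫⁻ ω, ENNReal.ofReal (h ω) ∂μ = 1) :
    Integrable h μ ∧ ∫ ω, h ω ∂μ = 1 := by
  refine ⟨(lintegral_ofReal_ne_top_iff_integrable hm.aestronglyMeasurable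
    (Filter.Eventually.of_forall h0)).1 (by simp [h1]), ?_⟩
  rw [integral_eq_lintegral_of_nonneg_ae (Filter.Eventually.of_forall h0) hm.aestronglyMeasurable,
    h1, ENNReal.toReal_one]

theorem klDiv_withDensity_exp {Ω : Type*} [MeasurableSpace Ω] {ρ ν : Measure Ω}
    [IsProbabilityMeasure ρ] [IsProbabilityMeasure ν] {Ψ : Ω → ℝ} (hm : Measurable Ψ)
    (hρ : ρ = ν.withDensity (fun ω ↦ ENNReal.ofReal (Real.exp (Ψ ω)))) (hint : Integrable Ψ ρ) :
    klDiv ρ ν = ENNReal.ofReal (∫ ω, Ψ ω ∂ρ) := by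
  have hac : ρ ≪ ν := by rw [hρ]; exact withDensity_absolutelyContinuous _ _
  have hd : ρ.rnDeriv ν =ᵐ[ν] fun ω ↦ ENNReal.ofReal (Real.exp (Ψ ω)) := by
    conv_lhs => rw [hρ]
    exact Measure.rnDeriv_withDensity ν (by fun_prop)
  have hllr : llr ρ ν =ᵐ[ρ] Ψ := by
    filter_upwards [hac.ae_le hd] with ω hω
    rw [llr, hω, ENNReal.toReal_ofReal (Real.exp_pos _).le, Real.log_exp]
  rw [klDiv_of_ac_of_integrable hac ((integrable_congr hllr).2 hint), integral_congr_ae hllr]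
  simp

end GaussianRatio

/-! ### Mutual information as a sum of log-variance ratios -/

section InfoGain

variable {𝒳 : Type*} [Fintype 𝒳] [MeasurableSpace 𝒳] [MeasurableSingletonClass 𝒳] {n : ℕ}

/-- The log-density of the joint law of the observations and of the values `g` of the path at the
inputs, with respect to the product of the marginals. -/
def infoDensity (k : 𝒳 → 𝒳 → ℝ) (σ : ℝ) : (n : ℕ) → Dataset 𝒳 n → (Fin n → ℝ) → ℝ
  | 0, _, _ => 0
  | n + 1, D, g => infoDensity k σ n (Fin.init D) (Fin.init g) +
      gaussLogRatio (g (Fin.last n)) (σ ^ 2)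
        (postMean k σ (Fin.init D : Dataset 𝒳 n) (D (Fin.last n)).1)
        (postCov k σ (Fin.init D : Dataset 𝒳 n) (D (Fin.last n)).1 (D (Fin.last n)).1 + σ ^ 2)
        (D (Fin.last n)).2

/-- The sum of the `½ log (1 + σ⁻² σᵢ²(xᵢ))` along a sequence of inputs. -/
def infoGain {𝒳 : Type*} (k : 𝒳 → 𝒳 → ℝ) (σ : ℝ) : (n : ℕ) → (Fin n → 𝒳) → ℝ
  | 0, _ => 0
  | n + 1, xs => infoGain k σ n (Fin.init xs) + (1 / 2) * Real.log
      ((postCov k σ (fun i : Fin n ↦ (xs (Fin.castSucc i), 0)) (xs (Fin.last n)) (xs (Fin.last n)) +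
        σ ^ 2) / σ ^ 2)

omit [Fintype 𝒳] [MeasurableSingletonClass 𝒳] in
theorem measurable_init : Measurable (Fin.init : Dataset 𝒳 (n + 1) → Dataset 𝒳 n) :=
  measurable_pi_lambda _ fun i ↦ measurable_pi_apply (Fin.castSucc i)

theorem measurable_infoDensity (k : 𝒳 → 𝒳 → ℝ) (σ : ℝ) (n : ℕ) :
    Measurable (fun p : Dataset 𝒳 n × (Fin n → ℝ) ↦ infoDensity k σ n p.1 p.2) := by
  induction n with
  | zero => simp only [infoDensity]; fun_prop
  | succ n ih =>
    have h1 : Measurable (fun p : Dataset 𝒳 (n + 1) × (Fin (n + 1) → ℝ) ↦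
        ((Fin.init p.1 : Dataset 𝒳 n), (Fin.init p.2 : Fin n → ℝ))) :=
      (measurable_init.comp measurable_fst).prodMk (measurable_pi_lambda _ fun i ↦ by
        simp only [Fin.init]; fun_prop)
    have h2 : Measurable (fun p : Dataset 𝒳 (n + 1) × (Fin (n + 1) → ℝ) ↦
        ((Fin.init p.1 : Dataset 𝒳 n), (p.1 (Fin.last n)).1)) :=
      (measurable_init.comp measurable_fst).prodMk (by fun_prop)
    have h3 := (measurable_postMean_uncurry k σ).comp h2
    have h4 := (measurable_postCov_self_uncurry k σ).comp h2
    simp only [Function.comp_def] at h3 h4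
    have h5 := ih.comp h1
    simp only [Function.comp_def] at h5
    simp only [infoDensity, gaussLogRatio]
    fun_prop

/-- The values of a path at the inputs of a dataset. -/
def pathValues {𝒳 : Type*} {n : ℕ} (p : Dataset 𝒳 n × (𝒳 → ℝ)) : Fin n → ℝ := fun i ↦ p.2 (p.1 i).1

theorem measurable_pathValues : Measurable (pathValues (𝒳 := 𝒳) (n := n)) :=
  measurable_pi_lambda _ fun i ↦ measurable_eval_uncurry.comp
    (by fun_prop : Measurable fun p : Dataset 𝒳 n × (𝒳 → ℝ) ↦ (p.2, (p.1 i).1))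

theorem measurable_infoDensity_pathValues (k : 𝒳 → 𝒳 → ℝ) (σ : ℝ) (n : ℕ) :
    Measurable (fun p : Dataset 𝒳 n × (𝒳 → ℝ) ↦ infoDensity k σ n p.1 (pathValues p)) :=
  (measurable_infoDensity k σ n).comp (measurable_fst.prodMk measurable_pathValues)

omit [Fintype 𝒳] [MeasurableSpace 𝒳] [MeasurableSingletonClass 𝒳] in
theorem infoDensity_snoc (k : 𝒳 → 𝒳 → ℝ) (σ : ℝ) (D : Dataset 𝒳 n) (x : 𝒳) (y : ℝ) (f : 𝒳 → ℝ) :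
    infoDensity k σ (n + 1) (Fin.snoc D (x, y)) (pathValues (Fin.snoc D (x, y), f)) =
      infoDensity k σ n D (pathValues (D, f)) +
        gaussLogRatio (f x) (σ ^ 2) (postMean k σ D x) (postCov k σ D x x + σ ^ 2) y := by
  have h : (Fin.init (pathValues ((Fin.snoc D (x, y) : Dataset 𝒳 (n + 1)), f)) : Fin n → ℝ) =
      pathValues (D, f) := by
    funext i; simp [Fin.init, pathValues]
  rw [infoDensity, Fin.init_snoc, h]
  simp [pathValues]

variable {k : 𝒳 → 𝒳 → ℝ} {σ : ℝ}

omit [Fintype 𝒳] in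
theorem measurableSet_inputs_eq (a : Fin n → 𝒳) :
    MeasurableSet {D : Dataset 𝒳 n | ∀ i, (D i).1 = a i} := by
  have : {D : Dataset 𝒳 n | ∀ i, (D i).1 = a i} = (fun D i ↦ (D i).1) ⁻¹' {a} := by
    ext p; simp [funext_iff]
  rw [this]
  exact (by fun_prop : Measurable fun (p : Dataset 𝒳 n) i ↦ (p i).1) (measurableSet_singleton a)

theorem ae_initLaw_inputs_eq (k : 𝒳 → 𝒳 → ℝ) (σ : ℝ) (a : Fin n → 𝒳) :
    ∀ᵐ p ∂initLaw k σ a, ∀ i, (p.1 i).1 = a i :=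
  (ae_map_iff (measurable_observe a).aemeasurable
    (measurable_fst (measurableSet_inputs_eq a))).2 (Filter.Eventually.of_forall fun _ _ ↦ rfl)

omit [MeasurableSingletonClass 𝒳] in
theorem snd_initLaw (k : 𝒳 → 𝒳 → ℝ) (σ : ℝ) (a : Fin n → 𝒳) :
    (initLaw k σ a).snd = gpLaw k := by
  rw [initLaw, Measure.snd, Measure.map_map measurable_snd (measurable_observe a)]
  change Measure.map Prod.fst _ = _
  rw [Measure.map_fst_prod, measure_univ, one_smul]

/-- Chain rule for densities: given the path, the next observation has law `N(f(x), σ²)`; given only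
the past data, it has the predictive law. Their ratio is the factor gained at each step. -/
theorem initLaw_eq_withDensity (hk : (Matrix.of k).PosSemidef) (hσ : 0 < σ) (a : Fin n → 𝒳) :
    initLaw k σ a = ((initLaw k σ a).fst.prod (gpLaw k)).withDensity
      (fun p ↦ ENNReal.ofReal (Real.exp (infoDensity k σ n p.1 (pathValues p)))) := by
  induction n with
  | zero =>
    have hfst : (initLaw k σ a).fst = Measure.dirac (fun i ↦ i.elim0) := by
      refine Measure.ext_of_lintegral _ fun φ _ ↦ ?_
      have h (D : Dataset 𝒳 0) : φ D = φ (fun i ↦ i.elim0) := congrArg φ (Subsingleton.elim _ _)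
      simp [lintegral_congr h]
    refine Measure.ext_of_lintegral _ fun φ hφ ↦ ?_
    simp only [infoDensity, Real.exp_zero, ENNReal.ofReal_one]
    rw [← Pi.one_def, withDensity_one, hfst, lintegral_prod _ hφ.aemeasurable,
      lintegral_dirac' _ hφ.lintegral_prod_right', lintegral_initLaw _ _ _ hφ]
    refine lintegral_congr fun f ↦ ?_
    rw [Measure.pi_of_empty _ (fun i ↦ i.elim0),
      lintegral_dirac' _ (f := fun e : Fin 0 → ℝ ↦ φ (fun i ↦ (a i, f (a i) + e i), f))
        (hφ.comp (by fun_prop))]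
    congr 2
    exact Subsingleton.elim _ _
  | succ n ih =>
    have hpost := isPosteriorLaw_initLaw hk hσ (fun i ↦ a (Fin.castSucc i))
    have hσ2 : 0 < σ ^ 2 := by positivity
    rw [initLaw_succ, hpost.fst_extendLaw hk hσ]
    set x := a (Fin.last n)
    set ρ := initLaw k σ (fun i ↦ a (Fin.castSucc i))
    set q : Kernel (Dataset 𝒳 n) 𝒳 := Kernel.const _ (Measure.dirac x)
    refine Measure.ext_of_lintegral _ fun φ hφ ↦ ?_
    have hw := (measurable_infoDensity_pathValues k σ (n + 1)).exp.ennreal_ofReal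
    have hwφ : Measurable (fun p : Dataset 𝒳 (n + 1) × (𝒳 → ℝ) ↦
      ENNReal.ofReal (Real.exp (infoDensity k σ (n + 1) p.1 (pathValues p))) * φ p) := hw.mul hφ
    have hw' := (measurable_infoDensity_pathValues k σ n).exp.ennreal_ofReal
    have hm : Measurable (fun p : ((Dataset 𝒳 n × (𝒳 → ℝ)) × 𝒳) × ℝ ↦
        φ (Fin.snoc p.1.1.1 (p.1.2, p.1.1.2 p.1.2 + p.2), p.1.1.2)) := hφ.comp measurable_extend
    have hm1 : Measurable (fun p : (Dataset 𝒳 n × (𝒳 → ℝ)) × 𝒳 ↦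
        ∫⁻ e, φ (Fin.snoc p.1.1 (p.2, p.1.2 p.2 + e), p.1.2) ∂noiseLaw σ) :=
      hm.lintegral_prod_right'
    have hm2 : Measurable (fun p : Dataset 𝒳 n × (𝒳 → ℝ) ↦ ∫⁻ e,
        φ (Fin.snoc p.1 (x, p.2 x + e), p.2) ∂noiseLaw σ) :=
      hm1.comp (by fun_prop : Measurable fun p : Dataset 𝒳 n × (𝒳 → ℝ) ↦ (p, x))
    rw [lintegral_withDensity_eq_lintegral_mul _ hw hφ,
      lintegral_prod _ (hw.mul hφ).aemeasurable, lintegral_extendLaw _ _ _ hφ,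
      lintegral_dataStep _ _ _ _ (hw.mul hφ).lintegral_prod_right']
    simp only [q, Kernel.const_apply, lintegral_dirac, Pi.mul_apply, infoDensity_snoc]
    have hρ : ∫⁻ p, ∫⁻ e, φ (Fin.snoc p.1 (x, p.2 x + e), p.2) ∂noiseLaw σ ∂ρ =
        ∫⁻ p, ∫⁻ e, φ (Fin.snoc p.1 (x, p.2 x + e), p.2) ∂noiseLaw σ
          ∂((ρ.fst.prod (gpLaw k)).withDensity
            (fun p ↦ ENNReal.ofReal (Real.exp (infoDensity k σ n p.1 (pathValues p))))) :=
      congrArg (fun μ ↦ ∫⁻ p, ∫⁻ e, φ (Fin.snoc p.1 (x, p.2 x + e), p.2) ∂noiseLaw σ ∂μ) (ih _)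
    rw [hρ, lintegral_withDensity_eq_lintegral_mul _ hw' hm2,
      lintegral_prod _ (hw'.mul hm2).aemeasurable]
    refine lintegral_congr fun D ↦ ?_
    simp only [Pi.mul_apply]
    have hDy : Measurable (fun p : ℝ × (𝒳 → ℝ) ↦ (Fin.snoc D (x, p.1) : Dataset 𝒳 (n + 1))) :=
      measurable_snoc.comp (by fun_prop : Measurable fun p : ℝ × (𝒳 → ℝ) ↦ ((D, x), p.1))
    have hsw : Measurable (Function.uncurry fun (y : ℝ) (f : 𝒳 → ℝ) ↦
        ENNReal.ofReal (Real.exp (infoDensity k σ n D (pathValues (D, f)) +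
          gaussLogRatio (f x) (σ ^ 2) (postMean k σ D x) (postCov k σ D x x + σ ^ 2) y)) *
          φ (Fin.snoc D (x, y), f)) := by
      have := hwφ.comp (hDy.prodMk measurable_snd)
      simpa only [Function.comp_def, infoDensity_snoc, Function.uncurry_def] using this
    -- Under the product of the marginals the observation is independent of the path, so the path
    -- can be fixed first.
    rw [lintegral_lintegral_swap hsw.aemeasurable]
    refine lintegral_congr fun f ↦ ?_
    have hφf : Measurable (fun y ↦ φ (Fin.snoc D (x, y), f)) :=
      hφ.comp ((hDy.comp (by fun_prop : Measurable fun y : ℝ ↦ (y, f))).prodMk measurable_const)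
    have hnoise : ∫⁻ e, φ (Fin.snoc D (x, f x + e), f) ∂noiseLaw σ =
        ∫⁻ y, φ (Fin.snoc D (x, y), f) ∂gaussianReal (f x) (Real.toNNReal (σ ^ 2)) := by
      rw [← zero_add (f x), ← gaussianReal_map_const_add, lintegral_map hφf (by fun_prop),
        zero_add, noiseLaw]
    rw [hnoise, predKernel_apply, lintegral_gaussianReal_eq_lintegral_exp_gaussLogRatio (f x)
      (postMean k σ D x) hσ2 (postCov_self_add_pos hk hσ D x) hφf,
      ← lintegral_const_mul' _ _ ENNReal.ofReal_ne_top]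
    refine lintegral_congr fun y ↦ ?_
    rw [Real.exp_add, ENNReal.ofReal_mul (Real.exp_pos _).le, mul_assoc]

theorem map_init_extendLaw (σ : ℝ) (ρ : Measure (Dataset 𝒳 n × (𝒳 → ℝ))) [SFinite ρ]
    (q : Kernel (Dataset 𝒳 n) 𝒳) [IsMarkovKernel q] :
    (extendLaw σ ρ q).map (fun p ↦ ((Fin.init p.1 : Dataset 𝒳 n), p.2)) = ρ := by
  have hm : Measurable (fun p : Dataset 𝒳 (n + 1) × (𝒳 → ℝ) ↦
      ((Fin.init p.1 : Dataset 𝒳 n), p.2)) :=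
    (measurable_init.comp measurable_fst).prodMk measurable_snd
  refine Measure.ext_of_lintegral _ fun φ hφ ↦ ?_
  have hφm : Measurable (fun p : Dataset 𝒳 (n + 1) × (𝒳 → ℝ) ↦
    φ ((Fin.init p.1 : Dataset 𝒳 n), p.2)) := hφ.comp hm
  rw [lintegral_map hφ hm, lintegral_extendLaw _ _ _ hφm]
  simp

/-- Both quadratic terms of each log-ratio have mean `1` and enter with opposite signs. Only the
logarithm survives, and it is deterministic because posterior variances depend on the fixed inputs
alone. -/
theorem integrable_infoDensity (hk : (Matrix.of k).PosSemidef) (hσ : 0 < σ) (a : Fin n → 𝒳) :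
    Integrable (fun p ↦ infoDensity k σ n p.1 (pathValues p)) (initLaw k σ a) ∧
      ∫ p, infoDensity k σ n p.1 (pathValues p) ∂initLaw k σ a = infoGain k σ n a := by
  induction n with
  | zero => simp [infoDensity, infoGain]
  | succ n ih =>
    have hσ2 : 0 < σ ^ 2 := by positivity
    have hpost := isPosteriorLaw_initLaw hk hσ (fun i ↦ a (Fin.castSucc i))
    obtain ⟨ih1, ih2⟩ := ih (fun i ↦ a (Fin.castSucc i))
    have hlast := ae_initLaw_inputs_eq k σ a
    set x := a (Fin.last n)
    set S := postCov k σ (fun i : Fin n ↦ (a (Fin.castSucc i), 0)) x x + σ ^ 2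
    have hproj : Measurable (fun p : Dataset 𝒳 (n + 1) × (𝒳 → ℝ) ↦
        ((Fin.init p.1 : Dataset 𝒳 n), p.2)) :=
      (measurable_init.comp measurable_fst).prodMk measurable_snd
    have hmap := map_init_extendLaw σ (initLaw k σ (fun i ↦ a (Fin.castSucc i)))
      (Kernel.const _ (Measure.dirac x))
    rw [← initLaw_succ] at hmap
    have hm := measurable_infoDensity_pathValues k σ n
    rw [← hmap, integrable_map_measure hm.aestronglyMeasurable hproj.aemeasurable] at ih1
    rw [← hmap, integral_map hproj.aemeasurable hm.aestronglyMeasurable] at ih2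
    have hmA : Measurable (fun p : Dataset 𝒳 (n + 1) × (𝒳 → ℝ) ↦
        ((p.1 (Fin.last n)).2 - p.2 x) ^ 2 / σ ^ 2) := by fun_prop
    have hmμ : Measurable (fun D : Dataset 𝒳 (n + 1) ↦
        postMean k σ (Fin.init D : Dataset 𝒳 n) x) := (measurable_postMean k σ x).comp measurable_init
    have hmS : Measurable (fun D : Dataset 𝒳 (n + 1) ↦
        postCov k σ (Fin.init D : Dataset 𝒳 n) x x) := (measurable_postCov k σ x x).comp measurable_init
    have hmB : Measurable (fun D : Dataset 𝒳 (n + 1) ↦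
        ((D (Fin.last n)).2 - postMean k σ (Fin.init D : Dataset 𝒳 n) x) ^ 2 /
          (postCov k σ (Fin.init D : Dataset 𝒳 n) x x + σ ^ 2)) := by fun_prop
    -- Here the deviation from `f(x)` is exactly the fresh noise.
    obtain ⟨hA1, hA2⟩ := integrable_and_integral_eq_one (μ := initLaw k σ a) hmA
      (fun p ↦ by positivity) (by
        rw [initLaw_succ, lintegral_extendLaw _ _ _ hmA.ennreal_ofReal]
        have h := lintegral_sq_div_gaussianReal 0 hσ2
        simp only [sub_zero] at h
        simp only [Fin.snoc_last, Kernel.const_apply, lintegral_dirac]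
        simp [x, noiseLaw, h])
    -- This term involves the dataset only, so its mean is taken under the predictive law.
    obtain ⟨hB1, hB2⟩ := integrable_and_integral_eq_one (μ := initLaw k σ a)
      (hmB.comp measurable_fst)
      (fun p ↦ div_nonneg (sq_nonneg _) (postCov_self_add_pos hk hσ _ x).le) (by
        have h : ∫⁻ D, ENNReal.ofReal (((D (Fin.last n)).2 -
            postMean k σ (Fin.init D : Dataset 𝒳 n) x) ^ 2 /
            (postCov k σ (Fin.init D : Dataset 𝒳 n) x x + σ ^ 2)) ∂(initLaw k σ a).fst = 1 := by
          rw [initLaw_succ, hpost.fst_extendLaw hk hσ, lintegral_dataStep _ _ _ _ hmB.ennreal_ofReal]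
          simp only [Fin.snoc_last, Kernel.const_apply, lintegral_dirac, Fin.init_snoc,
            predKernel_apply, x]
          simp only [lintegral_sq_div_gaussianReal _ (postCov_self_add_pos hk hσ _ _)]
          simp
        rw [Measure.fst, lintegral_map hmB.ennreal_ofReal measurable_fst] at h
        exact h)
    set L : Dataset 𝒳 (n + 1) × (𝒳 → ℝ) → ℝ := fun p ↦
      infoDensity k σ n (Fin.init p.1) (pathValues ((Fin.init p.1 : Dataset 𝒳 n), p.2)) with hL
    set A : Dataset 𝒳 (n + 1) × (𝒳 → ℝ) → ℝ := fun p ↦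
      ((p.1 (Fin.last n)).2 - p.2 x) ^ 2 / σ ^ 2 with hAdef
    set B : Dataset 𝒳 (n + 1) × (𝒳 → ℝ) → ℝ := fun p ↦
      ((p.1 (Fin.last n)).2 - postMean k σ (Fin.init p.1 : Dataset 𝒳 n) x) ^ 2 /
        (postCov k σ (Fin.init p.1 : Dataset 𝒳 n) x x + σ ^ 2) with hBdef
    change Integrable L _ at ih1
    change ∫ p, L p ∂_ = _ at ih2
    change Integrable B _ at hB1
    change ∫ p, B p ∂_ = _ at hB2
    have hae : (fun p ↦ infoDensity k σ (n + 1) p.1 (pathValues p)) =ᵐ[initLaw k σ a]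
        fun p ↦ (L p + (1 / 2) * Real.log (S / σ ^ 2) - (1 / 2) * A p) + (1 / 2) * B p := by
      filter_upwards [hlast] with p hp
      have hS : postCov k σ (Fin.init p.1 : Dataset 𝒳 n) x x + σ ^ 2 = S := by
        have : (fun i : Fin n ↦ ((Fin.init p.1 : Dataset 𝒳 n) i).1) =
            fun i ↦ a (Fin.castSucc i) := funext fun i ↦ hp _
        change postCov k σ (fun i : Fin n ↦ (((Fin.init p.1 : Dataset 𝒳 n) i).1, 0)) x x + σ ^ 2 = S
        simp only [S, hp, Fin.init]
      have hp2 : pathValues p (Fin.last n) = p.2 x := by rw [pathValues, hp]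
      have hp3 : (Fin.init (pathValues p) : Fin n → ℝ) =
        pathValues ((Fin.init p.1 : Dataset 𝒳 n), p.2) := rfl
      simp only [hL, hAdef, hBdef]
      rw [infoDensity, hp, hp2, hp3, gaussLogRatio, hS]
      ring
    have i1 : Integrable (fun p ↦ L p + (1 / 2) * Real.log (S / σ ^ 2)) (initLaw k σ a) :=
      ih1.add (integrable_const _)
    have i2 : Integrable (fun p ↦ L p + (1 / 2) * Real.log (S / σ ^ 2) - (1 / 2) * A p)
        (initLaw k σ a) := i1.sub (hA1.const_mul (1 / 2))
    refine ⟨(integrable_congr hae).2 (i2.add (hB1.const_mul (1 / 2))), ?_⟩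
    rw [integral_congr_ae hae, integral_add i2 (hB1.const_mul (1 / 2)),
      integral_sub i1 (hA1.const_mul (1 / 2)), integral_add ih1 (integrable_const _),
      integral_const_mul (1 / 2) A, integral_const_mul (1 / 2) B, hA2, hB2, ih2]
    simp only [integral_const, probReal_univ, one_smul, infoGain]
    have : infoGain k σ n (fun i ↦ a (Fin.castSucc i)) = infoGain k σ n (Fin.init a) := rfl
    rw [this]
    ring

/-- The density of `initLaw` reads the path only at the inputs, and the inputs are almost surely
`a`. It therefore descends to the law of `(y_A, f_A)`, and the divergence is the mean of its
logarithm. -/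
theorem mutualInfo_obsLaw (hk : (Matrix.of k).PosSemidef) (hσ : 0 < σ) (a : Fin n → 𝒳) :
    mutualInfo (obsLaw k σ a) = ENNReal.ofReal (infoGain k σ n a) := by
  have hm1 : Measurable (fun (D : Dataset 𝒳 n) i ↦ (D i).2) := by fun_prop
  have hm2 : Measurable (fun (f : 𝒳 → ℝ) i ↦ f (a i)) := by fun_prop
  have hπ : Measurable (Prod.map (fun (D : Dataset 𝒳 n) i ↦ (D i).2)
    (fun (f : 𝒳 → ℝ) i ↦ f (a i))) := hm1.prodMap hm2
  set ρ := initLaw k σ a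
  have hobs : obsLaw k σ a = ρ.map (Prod.map (fun D i ↦ (D i).2) (fun f i ↦ f (a i))) := by
    simp only [ρ, initLaw]
    rw [Measure.map_map hπ (measurable_observe a)]
    rfl
  have hsndρ : ρ.snd = gpLaw k := snd_initLaw k σ a
  have hpr : IsProbabilityMeasure (obsLaw k σ a) := by
    rw [hobs]; exact Measure.isProbabilityMeasure_map hπ.aemeasurable
  have hprod : (obsLaw k σ a).fst.prod (obsLaw k σ a).snd =
      (ρ.fst.prod (gpLaw k)).map (Prod.map (fun D i ↦ (D i).2) (fun f i ↦ f (a i))) := by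
    rw [← Measure.map_prod_map _ _ hm1 hm2, hobs, ← hsndρ]
    simp only [Measure.fst, Measure.snd]
    rw [Measure.map_map measurable_fst hπ, Measure.map_map measurable_snd hπ,
      Measure.map_map hm1 measurable_fst, Measure.map_map hm2 measurable_snd]
    rfl
  have hinρ : ∀ᵐ p ∂ρ, ∀ i, (p.1 i).1 = a i := ae_initLaw_inputs_eq k σ a
  have hin : ∀ᵐ D ∂ρ.fst, ∀ i, (D i).1 = a i := by
    rw [Measure.fst, ae_map_iff measurable_fst.aemeasurable (measurableSet_inputs_eq a)]
    exact hinρ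
  have hinprod : ∀ᵐ p ∂ρ.fst.prod (gpLaw k), ∀ i, (p.1 i).1 = a i :=
    Measure.quasiMeasurePreserving_fst.ae hin
  set Ψ : (Fin n → ℝ) × (Fin n → ℝ) → ℝ := fun p ↦ infoDensity k σ n (fun i ↦ (a i, p.1 i)) p.2
  have hΨ : Measurable Ψ := (measurable_infoDensity k σ n).comp
    (by fun_prop : Measurable fun p : (Fin n → ℝ) × (Fin n → ℝ) ↦
      ((fun i ↦ (a i, p.1 i) : Dataset 𝒳 n), p.2))
  have hΨeq (p : Dataset 𝒳 n × (𝒳 → ℝ)) (hp : ∀ i, (p.1 i).1 = a i) :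
      Ψ (Prod.map (fun D i ↦ (D i).2) (fun f i ↦ f (a i)) p) =
        infoDensity k σ n p.1 (pathValues p) := by
    simp only [Ψ, Prod.map, ← hp]
    rfl
  obtain ⟨hint, hval⟩ := integrable_infoDensity hk hσ a
  have haeρ : (fun p ↦ Ψ (Prod.map (fun D i ↦ (D i).2) (fun f i ↦ f (a i)) p)) =ᵐ[ρ]
      fun p ↦ infoDensity k σ n p.1 (pathValues p) := hinρ.mono hΨeq
  have hdens : obsLaw k σ a = ((obsLaw k σ a).fst.prod (obsLaw k σ a).snd).withDensity
      (fun p ↦ ENNReal.ofReal (Real.exp (Ψ p))) := by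
    rw [hprod]
    refine Measure.ext_of_lintegral _ fun φ hφ ↦ ?_
    have hw := (measurable_infoDensity_pathValues k σ n).exp.ennreal_ofReal
    rw [lintegral_withDensity_eq_lintegral_mul _ hΨ.exp.ennreal_ofReal hφ,
      lintegral_map (hΨ.exp.ennreal_ofReal.mul hφ) hπ, hobs, lintegral_map hφ hπ]
    refine (congrArg (fun μ ↦ ∫⁻ p, (φ ∘ Prod.map (fun D i ↦ (D i).2) (fun f i ↦ f (a i))) p ∂μ)
      (initLaw_eq_withDensity hk hσ a)).trans ?_
    rw [lintegral_withDensity_eq_lintegral_mul _ hw (hφ.comp hπ)]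
    refine lintegral_congr_ae (hinprod.mono fun p hp ↦ ?_)
    simp only [Pi.mul_apply, hΨeq p hp, Function.comp_apply]
  rw [mutualInfo, klDiv_withDensity_exp hΨ hdens]
  · rw [hobs, integral_map hπ.aemeasurable hΨ.aestronglyMeasurable, integral_congr_ae haeρ, hval]
  · rw [hobs, integrable_map_measure hΨ.aestronglyMeasurable hπ.aemeasurable]
    exact (integrable_congr haeρ).2 hint

theorem infoGain_le_maxInfoGain (hk : (Matrix.of k).PosSemidef) (hσ : 0 < σ) (a : Fin n → 𝒳) :
    infoGain k σ n a ≤ maxInfoGain k σ n := by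
  -- An infinite supremum would be sent to `0` by `toReal`; a finite sum of finite terms rules it
  -- out.
  have hfin : (⨆ a : Fin n → 𝒳, mutualInfo (obsLaw k σ a)) ≠ ∞ := by
    classical
    refine ne_top_of_le_ne_top (b := ∑ a : Fin n → 𝒳, mutualInfo (obsLaw k σ a)) ?_
      (iSup_le fun a ↦ Finset.single_le_sum (f := fun a ↦ mutualInfo (obsLaw k σ a))
        (fun _ _ ↦ zero_le) (Finset.mem_univ a))
    simp [mutualInfo_obsLaw hk hσ]
  have h := ENNReal.toReal_mono hfin (le_iSup (fun a ↦ mutualInfo (obsLaw k σ a)) a)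
  rw [mutualInfo_obsLaw hk hσ] at h
  exact (by rw [ENNReal.toReal_ofReal']; exact le_max_left _ _ : infoGain k σ n a ≤ _).trans h

end InfoGain

/-! ### Excess of a squared Gaussian positive part -/

section TailBound

/-- The part of the squared positive part of `z` that exceeds `c`. -/
def excess (c z : ℝ) : ℝ := max (max z 0 ^ 2 - c) 0

theorem excess_nonneg (c z : ℝ) : 0 ≤ excess c z := le_max_right _ _

theorem sq_max_le_add_excess (c z : ℝ) : max z 0 ^ 2 ≤ c + excess c z := by
  have := le_max_left (max z 0 ^ 2 - c) 0
  rw [excess]; linarith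

theorem measurable_excess (c : ℝ) : Measurable (excess c) := by
  unfold excess; fun_prop

/-- With `b = a * u` the left side is `exp(-b) (2b + u²)`, and `2b ≤ 1 + b + b²/2 ≤ exp b`. -/
theorem exp_neg_mul_le {a u : ℝ} (ha : 0 ≤ a) (hu : 0 ≤ u) :
    Real.exp (-(a * u)) * ((a + u) ^ 2 - a ^ 2) ≤ u ^ 2 + 1 := by
  have hau : 0 ≤ a * u := by positivity
  have h := Real.quadratic_le_exp_of_nonneg hau
  have h1 : 1 ≤ Real.exp (a * u) := Real.one_le_exp hau
  rw [Real.exp_neg, inv_mul_le_iff₀ (Real.exp_pos _)]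
  nlinarith [sq_nonneg (a * u - 1), mul_le_mul_of_nonneg_left h1 (sq_nonneg u)]

/-- By symmetry, at most half of the total mean `2`. -/
theorem setLIntegral_Ioi_sq_add_one_gaussianReal :
    ∫⁻ u in Set.Ioi (0 : ℝ), ENNReal.ofReal (u ^ 2 + 1) ∂gaussianReal 0 1 ≤ 1 := by
  have hm : Measurable (fun u : ℝ ↦ ENNReal.ofReal (u ^ 2 + 1)) := by fun_prop
  have hsymm : ∫⁻ u in Set.Ioi (0 : ℝ), ENNReal.ofReal (u ^ 2 + 1) ∂gaussianReal 0 1 =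
      ∫⁻ u in Set.Iio (0 : ℝ), ENNReal.ofReal (u ^ 2 + 1) ∂gaussianReal 0 1 := by
    have h := gaussianReal_map_neg (μ := 0) (v := 1)
    rw [neg_zero] at h
    conv_lhs => rw [← h]
    rw [setLIntegral_map measurableSet_Ioi hm measurable_neg]
    congr 1
    · congr 1; ext x; simp
    · simp
  have htot : ∫⁻ u, ENNReal.ofReal (u ^ 2 + 1) ∂gaussianReal 0 1 = 2 := by
    have h := lintegral_sq_div_gaussianReal 0 one_pos
    simp only [sub_zero, div_one, Real.toNNReal_one] at h
    have h2 (u : ℝ) : ENNReal.ofReal (u ^ 2 + 1) = ENNReal.ofReal (u ^ 2) + 1 := by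
      rw [ENNReal.ofReal_add (sq_nonneg u) zero_le_one, ENNReal.ofReal_one]
    simp only [h2]
    rw [lintegral_add_right _ measurable_const, h]
    simp [one_add_one_eq_two]
  have hle : 2 * ∫⁻ u in Set.Ioi (0 : ℝ), ENNReal.ofReal (u ^ 2 + 1) ∂gaussianReal 0 1 ≤ 2 * 1 := by
    rw [two_mul, mul_one, ← htot]
    nth_rw 2 [hsymm]
    rw [← lintegral_union measurableSet_Iio
      (Set.disjoint_left.2 fun x hx hx' ↦ lt_asymm (Set.mem_Ioi.1 hx) hx')]
    exact setLIntegral_le_lintegral _ _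
  exact (ENNReal.mul_le_mul_iff_right two_ne_zero ENNReal.ofNat_ne_top).1 hle

/-- Shift by `a`: the Gaussian density at `a + u` is `exp(-a²/2) exp(-a u)` times that at `u`, the
excess vanishes for `u ≤ 0`, and `exp_neg_mul_le` removes the remaining dependence on `a`. -/
theorem lintegral_excess_gaussianReal_le {a : ℝ} (ha : 0 ≤ a) :
    ∫⁻ z, ENNReal.ofReal (excess (a ^ 2) z) ∂gaussianReal 0 1 ≤
      ENNReal.ofReal (Real.exp (-(a ^ 2 / 2))) := by
  have hm : Measurable (fun z ↦ ENNReal.ofReal (excess (a ^ 2) z)) :=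
    (measurable_excess _).ennreal_ofReal
  have hm2 : Measurable ((Set.Ioi (0 : ℝ)).indicator fun u : ℝ ↦ ENNReal.ofReal (u ^ 2 + 1)) :=
    Measurable.indicator (by fun_prop) measurableSet_Ioi
  calc ∫⁻ z, ENNReal.ofReal (excess (a ^ 2) z) ∂gaussianReal 0 1
      = ∫⁻ u, gaussianPDF 0 1 (a + u) * ENNReal.ofReal (excess (a ^ 2) (a + u)) := by
        rw [gaussianReal_of_var_ne_zero _ one_ne_zero,
          lintegral_withDensity_eq_lintegral_mul _ (measurable_gaussianPDF _ _) hm,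
          ← lintegral_add_left_eq_self _ a]
        rfl
    _ ≤ ∫⁻ u, ENNReal.ofReal (Real.exp (-(a ^ 2 / 2))) * (gaussianPDF 0 1 u *
          (Set.Ioi (0 : ℝ)).indicator (fun u : ℝ ↦ ENNReal.ofReal (u ^ 2 + 1)) u) := by
        refine lintegral_mono fun u ↦ ?_
        rcases le_or_gt u 0 with hu | hu
        · have h0 : excess (a ^ 2) (a + u) = 0 := by
            refine max_eq_right (sub_nonpos.2 ?_)
            exact pow_le_pow_left₀ (le_max_right _ _) (max_le (by linarith) ha) 2
          simp [h0]
        · rw [Set.indicator_of_mem (Set.mem_Ioi.2 hu), gaussianPDF, gaussianPDF,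
            ← ENNReal.ofReal_mul (gaussianPDFReal_nonneg _ _ _),
            ← ENNReal.ofReal_mul (gaussianPDFReal_nonneg _ _ _),
            ← ENNReal.ofReal_mul (Real.exp_pos _).le]
          refine ENNReal.ofReal_le_ofReal ?_
          have h0 : excess (a ^ 2) (a + u) = (a + u) ^ 2 - a ^ 2 := by
            rw [excess, max_eq_left (by positivity : 0 ≤ a + u), max_eq_left]
            nlinarith
          have hexp : Real.exp (-(a + u - 0) ^ 2 / (2 * ((1 : NNReal) : ℝ))) =
              Real.exp (-(a ^ 2 / 2)) * Real.exp (-(a * u)) *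
                Real.exp (-(u - 0) ^ 2 / (2 * ((1 : NNReal) : ℝ))) := by
            rw [← Real.exp_add, ← Real.exp_add]
            congr 1
            push_cast
            ring
          rw [h0, gaussianPDFReal, gaussianPDFReal, hexp]
          have h1 := exp_neg_mul_le ha hu.le
          calc _ = Real.exp (-(a ^ 2 / 2)) * ((√(2 * Real.pi * ((1 : NNReal) : ℝ)))⁻¹ *
                Real.exp (-(u - 0) ^ 2 / (2 * ((1 : NNReal) : ℝ)))) *
                (Real.exp (-(a * u)) * ((a + u) ^ 2 - a ^ 2)) := by ring
            _ ≤ Real.exp (-(a ^ 2 / 2)) * ((√(2 * Real.pi * ((1 : NNReal) : ℝ)))⁻¹ *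
                Real.exp (-(u - 0) ^ 2 / (2 * ((1 : NNReal) : ℝ)))) * (u ^ 2 + 1) := by gcongr
            _ = _ := by ring
    _ = ENNReal.ofReal (Real.exp (-(a ^ 2 / 2))) *
          ∫⁻ u in Set.Ioi (0 : ℝ), ENNReal.ofReal (u ^ 2 + 1) ∂gaussianReal 0 1 := by
        rw [lintegral_const_mul' _ _ ENNReal.ofReal_ne_top, ← lintegral_indicator measurableSet_Ioi,
          gaussianReal_of_var_ne_zero _ one_ne_zero,
          lintegral_withDensity_eq_lintegral_mul _ (measurable_gaussianPDF _ _) hm2]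
        rfl
    _ ≤ ENNReal.ofReal (Real.exp (-(a ^ 2 / 2))) * 1 := by
        gcongr
        exact setLIntegral_Ioi_sq_add_one_gaussianReal
    _ = _ := mul_one _

theorem integrable_excess_gaussianReal {c : ℝ} (hc : 0 ≤ c) :
    Integrable (excess c) (gaussianReal 0 1) ∧
      ∫ z, excess c z ∂gaussianReal 0 1 ≤ Real.exp (-(c / 2)) := by
  have h := lintegral_excess_gaussianReal_le (Real.sqrt_nonneg c)
  rw [Real.sq_sqrt hc] at h
  refine ⟨(lintegral_ofReal_ne_top_iff_integrable (measurable_excess c).aestronglyMeasurable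
    (Filter.Eventually.of_forall (excess_nonneg c))).1 (ne_top_of_le_ne_top ENNReal.ofReal_ne_top h),
    ?_⟩
  rw [integral_eq_lintegral_of_nonneg_ae (Filter.Eventually.of_forall (excess_nonneg c))
    (measurable_excess c).aestronglyMeasurable]
  exact ENNReal.toReal_le_of_le_ofReal (Real.exp_pos _).le h

end TailBound

/-! ### Two scalar inequalities -/

section Inequalities

/-- Bernoulli's inequality `(1 + s⁻¹)^v ≤ 1 + v/s` for exponents in `[0, 1]`. -/
theorem mul_log_one_add_inv_le {s v : ℝ} (hs : 0 < s) (hv0 : 0 ≤ v) (hv1 : v ≤ 1) :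
    v * Real.log (1 + s⁻¹) ≤ Real.log ((v + s) / s) := by
  have hpos : 0 < 1 + s⁻¹ := by positivity
  rw [← Real.log_rpow hpos]
  refine Real.log_le_log (Real.rpow_pos_of_pos hpos v) ?_
  have h := rpow_one_add_le_one_add_mul_self (s := s⁻¹) (by have := inv_pos.2 hs; linarith) hv0 hv1
  refine h.trans (le_of_eq ?_)
  field_simp
  ring

theorem le_sqrt_mul_of_forall_le {R A B : ℝ} (hA : 0 ≤ A) (hB : 0 ≤ B)
    (h : ∀ l : ℝ, 0 < l → R ≤ l / 2 * A + 1 / (2 * l) * B) : R ≤ √(A * B) := by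
  -- The optimal `l = √(B/A)` is not available when `A` or `B` vanishes, so both are raised by `δ`,
  -- which then tends to `0`.
  have hδ (δ : ℝ) (hδ : 0 < δ) : R ≤ √((A + δ) * (B + δ)) := by
    have ha : 0 < √(A + δ) := Real.sqrt_pos.2 (by positivity)
    have hb : 0 < √(B + δ) := Real.sqrt_pos.2 (by positivity)
    have ha2 : √(A + δ) ^ 2 = A + δ := Real.sq_sqrt (by positivity)
    have hb2 : √(B + δ) ^ 2 = B + δ := Real.sq_sqrt (by positivity)
    have h1 := h (√(B + δ) / √(A + δ)) (by positivity)
    rw [Real.sqrt_mul (by positivity)]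
    refine h1.trans ?_
    calc _ ≤ √(B + δ) / √(A + δ) / 2 * √(A + δ) ^ 2 +
          1 / (2 * (√(B + δ) / √(A + δ))) * √(B + δ) ^ 2 := by
          rw [ha2, hb2]; gcongr <;> linarith
      _ = _ := by field_simp; ring
  have hlim : Filter.Tendsto (fun δ : ℝ ↦ √((A + δ) * (B + δ))) (nhdsWithin 0 (Set.Ioi 0))
      (nhds √((A + 0) * (B + 0))) :=
    (Continuous.tendsto (by fun_prop) 0).mono_left nhdsWithin_le_nhds
  rw [add_zero, add_zero] at hlim
  exact ge_of_tendsto hlim (Filter.eventually_of_mem self_mem_nhdsWithin hδ)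

end Inequalities

/-! ### Posterior variances bounded by the information gain -/

section VarianceSum

variable {𝒳 : Type*} {k : 𝒳 → 𝒳 → ℝ} {σ : ℝ}

/-- The sum of the posterior variances at the inputs that follow an initial dataset. -/
def varSum (k : 𝒳 → 𝒳 → ℝ) (σ : ℝ) (n₀ : ℕ) : (T : ℕ) → Dataset 𝒳 (n₀ + T) → ℝ
  | 0, _ => 0
  | T + 1, D => varSum k σ n₀ T (Fin.init (n := n₀ + T) D) +
      postVar k σ (Fin.init (n := n₀ + T) D : Dataset 𝒳 (n₀ + T)) (D (Fin.last (n₀ + T))).1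

variable [Fintype 𝒳]

theorem quadForm_postCov_le (hk : (Matrix.of k).PosSemidef) (hσ : 0 < σ) {n : ℕ}
    (D : Dataset 𝒳 n) (c : 𝒳 → ℝ) : quadForm (postCov k σ D) c ≤ quadForm k c := by
  induction n with
  | zero => rw [postCov_zero]
  | succ n ih =>
    rw [← Fin.snoc_init_self (α := fun _ ↦ 𝒳 × ℝ) D, ← Prod.mk.eta (p := D (Fin.last n)),
      postCov_snoc hk hσ, quadForm_condCov]
    refine (sub_le_self _ (div_nonneg (sq_nonneg _) ?_)).trans (ih _)
    exact (postCov_self_add_pos hk hσ _ _).le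

/-- Forgetting the initial data increases the covariance in the Loewner order. The induction needs
the whole quadratic form, since comparing variances alone is not preserved by conditioning. -/
theorem quadForm_postCov_le_natAdd (hk : (Matrix.of k).PosSemidef) (hσ : 0 < σ) {n₀ T : ℕ}
    (D : Dataset 𝒳 (n₀ + T)) (c : 𝒳 → ℝ) :
    quadForm (postCov k σ D) c ≤
      quadForm (postCov k σ (fun i : Fin T ↦ D (Fin.natAdd n₀ i))) c := by
  induction T generalizing c with
  | zero => rw [postCov_zero]; exact quadForm_postCov_le hk hσ D c
  | succ T ih =>
    have h1 : postCov k σ D = condCov (postCov k σ (Fin.init (n := n₀ + T) D : Dataset 𝒳 (n₀ + T)))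
        (σ ^ 2) (D (Fin.last (n₀ + T))).1 := by
      rw [← postCov_snoc hk hσ _ _ (D (Fin.last (n₀ + T))).2, Prod.mk.eta]
      exact congrArg (postCov k σ) (Fin.snoc_init_self (α := fun _ ↦ 𝒳 × ℝ) D).symm
    have h2 : postCov k σ (fun i : Fin (T + 1) ↦ D (Fin.natAdd n₀ i)) =
        condCov (postCov k σ (fun i : Fin T ↦
          (Fin.init (n := n₀ + T) D : Dataset 𝒳 (n₀ + T)) (Fin.natAdd n₀ i)))
        (σ ^ 2) (D (Fin.last (n₀ + T))).1 := by
      rw [← postCov_snoc hk hσ _ _ (D (Fin.last (n₀ + T))).2, Prod.mk.eta]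
      exact congrArg (postCov k σ) (Fin.snoc_init_self (α := fun _ ↦ 𝒳 × ℝ)
        (fun i : Fin (T + 1) ↦ D (Fin.natAdd n₀ i))).symm
    rw [h1, h2]
    exact quadForm_condCov_mono (posSemidef_postCov hk hσ _) (posSemidef_postCov hk hσ _)
      (by positivity) (ih _) _ c

/-- The variances of the run are conditioned on the initial data as well, whereas `infoGain` starts
from the prior; the Loewner comparison bridges the two, after Bernoulli's inequality term by term.
-/
theorem varSum_mul_log_le (hk : (Matrix.of k).PosSemidef) (hk1 : ∀ x, k x x = 1) (hσ : 0 < σ)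
    {n₀ T : ℕ} (D : Dataset 𝒳 (n₀ + T)) :
    varSum k σ n₀ T D * Real.log (1 + (σ ^ 2)⁻¹) ≤
      2 * infoGain k σ T (fun i ↦ (D (Fin.natAdd n₀ i)).1) := by
  classical
  induction T with
  | zero => simp [varSum, infoGain]
  | succ T ih =>
    have hσ2 : 0 < σ ^ 2 := by positivity
    set D' : Dataset 𝒳 (n₀ + T) := Fin.init (n := n₀ + T) D
    set x := (D (Fin.last (n₀ + T))).1
    have hle : postCov k σ D' x x ≤ postCov k σ (fun i : Fin T ↦ D' (Fin.natAdd n₀ i)) x x := by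
      rw [← quadForm_single (postCov k σ D'), ← quadForm_single (postCov k σ fun i : Fin T ↦ _)]
      exact quadForm_postCov_le_natAdd hk hσ D' _
    have hpos := postVar_pos hk hk1 hσ D' x
    have h1 := mul_log_one_add_inv_le hσ2 hpos.le (postVar_le_one hk hk1 hσ D' x)
    have h2 : Real.log ((postVar k σ D' x + σ ^ 2) / σ ^ 2) ≤
        Real.log ((postCov k σ (fun i : Fin T ↦ D' (Fin.natAdd n₀ i)) x x + σ ^ 2) / σ ^ 2) := by
      rw [postVar_eq_postCov] at hpos ⊢
      gcongr
    have h3 := ih D'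
    change (varSum k σ n₀ T D' + postVar k σ D' x) * _ ≤ 2 * (infoGain k σ T
      (fun i ↦ (D' (Fin.natAdd n₀ i)).1) + 1 / 2 * Real.log ((postCov k σ
        (fun i : Fin T ↦ D' (Fin.natAdd n₀ i)) x x + σ ^ 2) / σ ^ 2))
    linarith

theorem varSum_le [MeasurableSpace 𝒳] [MeasurableSingletonClass 𝒳]
    (hk : (Matrix.of k).PosSemidef) (hk1 : ∀ x, k x x = 1) (hσ : 0 < σ)
    {n₀ T : ℕ} (D : Dataset 𝒳 (n₀ + T)) :
    varSum k σ n₀ T D ≤ 2 / Real.log (1 + (σ ^ 2)⁻¹) * maxInfoGain k σ T := by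
  have hlog : 0 < Real.log (1 + (σ ^ 2)⁻¹) :=
    Real.log_pos (by have : 0 < (σ ^ 2)⁻¹ := by positivity
                     linarith)
  rw [div_mul_eq_mul_div, le_div_iff₀ hlog]
  refine (varSum_mul_log_le hk hk1 hσ D).trans ?_
  gcongr
  exact infoGain_le_maxInfoGain hk hσ _

end VarianceSum

/-! ### Expected regret of a single step -/

section OneStep

variable {𝒳 : Type*} [Fintype 𝒳] [MeasurableSpace 𝒳] [MeasurableSingletonClass 𝒳]
  {k : 𝒳 → 𝒳 → ℝ} {σ : ℝ} {n : ℕ}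

theorem gpKernel_map_eval (hk : (Matrix.of k).PosSemidef) (hσ : 0 < σ) (D : Dataset 𝒳 n) (x : 𝒳) :
    (gpKernel k σ n D).map (fun f ↦ f x) =
      gaussianReal (postMean k σ D x) (Real.toNNReal (postVar k σ D x)) := by
  have h := gaussianReal_map_const_add (μ := 0) (v := Real.toNNReal (postCov k σ D x x))
    (postMean k σ D x)
  rw [zero_add] at h
  rw [gpKernel_apply, Measure.map_map (by fun_prop) (by fun_prop), postVar_eq_postCov, ← h,
    ← gpLaw_map_eval (posSemidef_postCov hk hσ D) x, Measure.map_map (by fun_prop) (by fun_prop)]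
  rfl

theorem gpKernel_map_standardize (hk : (Matrix.of k).PosSemidef) (hk1 : ∀ x, k x x = 1)
    (hσ : 0 < σ) (D : Dataset 𝒳 n) (x : 𝒳) :
    (gpKernel k σ n D).map (fun f ↦ (f x - postMean k σ D x) / postStd k σ D x) =
      gaussianReal 0 1 := by
  have hv := postVar_pos hk hk1 hσ D x
  have h : (fun f : 𝒳 → ℝ ↦ (f x - postMean k σ D x) / postStd k σ D x) =
      (fun z ↦ z / postStd k σ D x) ∘ (fun z ↦ z - postMean k σ D x) ∘ (fun f ↦ f x) := rfl
  rw [h, ← Measure.map_map (by fun_prop) (by fun_prop), ← Measure.map_map (by fun_prop) (by fun_prop),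
    gpKernel_map_eval hk hσ, gaussianReal_map_sub_const, gaussianReal_map_div_const, sub_self, zero_div]
  congr 1
  have h2 : (NNReal.mk (postStd k σ D x ^ 2) (sq_nonneg _)) = Real.toNNReal (postVar k σ D x) :=
    NNReal.coe_injective ((Real.sq_sqrt hv.le).trans (Real.coe_toNNReal _ hv.le).symm)
  rw [h2, div_self (Real.toNNReal_pos.2 hv).ne']

theorem integrable_eval_gpKernel (hk : (Matrix.of k).PosSemidef) (hσ : 0 < σ) (D : Dataset 𝒳 n)
    (x : 𝒳) : Integrable (fun f ↦ f x) (gpKernel k σ n D) := by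
  have h : Integrable id ((gpKernel k σ n D).map (fun f ↦ f x)) := by
    rw [gpKernel_map_eval hk hσ]
    exact (memLp_id_gaussianReal 1).integrable le_rfl
  exact h.comp_measurable (by fun_prop)

theorem integral_eval_gpKernel (hk : (Matrix.of k).PosSemidef) (hσ : 0 < σ) (D : Dataset 𝒳 n)
    (x : 𝒳) : ∫ f, f x ∂gpKernel k σ n D = postMean k σ D x := by
  have h := integral_map (μ := gpKernel k σ n D) (φ := fun f ↦ f x)
    (measurable_pi_apply x).aemeasurable (f := id) (by fun_prop)
  rw [gpKernel_map_eval hk hσ] at h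
  simpa using h.symm

omit [MeasurableSpace 𝒳] [MeasurableSingletonClass 𝒳] in
theorem measurable_iSup_eval : Measurable (fun f : 𝒳 → ℝ ↦ ⨆ x, f x) :=
  Measurable.iSup fun x ↦ measurable_pi_apply x

theorem measurable_postVar_uncurry (k : 𝒳 → 𝒳 → ℝ) (σ : ℝ) :
    Measurable (fun p : Dataset 𝒳 n × 𝒳 ↦ postVar k σ p.1 p.2) :=
  measurable_postCov_self_uncurry k σ

theorem integrable_postVar {Ω : Type*} [MeasurableSpace Ω] {μ : Measure Ω} [IsFiniteMeasure μ]
    (hk : (Matrix.of k).PosSemidef) (hk1 : ∀ x, k x x = 1) (hσ : 0 < σ) {D : Ω → Dataset 𝒳 n}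
    {x : Ω → 𝒳} (hD : Measurable D) (hx : Measurable x) :
    Integrable (fun ω ↦ postVar k σ (D ω) (x ω)) μ := by
  refine Integrable.of_bound ((measurable_postVar_uncurry k σ).comp
    (hD.prodMk hx)).aestronglyMeasurable 1 (Filter.Eventually.of_forall fun ω ↦ ?_)
  rw [Real.norm_of_nonneg (postVar_pos hk hk1 hσ _ _).le]
  exact postVar_le_one hk hk1 hσ _ _

theorem IsPosteriorLaw.queryKernel_ae_eq {ρ : Measure (Dataset 𝒳 n × (𝒳 → ℝ))}
    [IsProbabilityMeasure ρ] (hρ : IsPosteriorLaw k σ ρ)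
    (sel : Kernel (Dataset 𝒳 n × (𝒳 → ℝ)) 𝒳) [IsMarkovKernel sel] :
    ∀ᵐ D ∂ρ.fst, queryKernel ρ sel D = (gpKernel k σ n D ⊗ₘ Kernel.sectR sel D).snd := by
  filter_upwards [hρ.posterior_ae_eq] with D hD
  have : IsMarkovKernel (posterior ρ) := by unfold posterior; infer_instance
  rw [queryKernel, Kernel.snd_apply, Kernel.compProd_apply_eq_compProd_sectR, hD, Measure.snd]

variable [Nonempty 𝒳]

omit [MeasurableSpace 𝒳] [MeasurableSingletonClass 𝒳] in
theorem abs_iSup_le_sum_abs (f : 𝒳 → ℝ) : |⨆ x, f x| ≤ ∑ x, |f x| := by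
  obtain ⟨x, hx⟩ := exists_eq_ciSup_of_finite (f := f)
  rw [← hx]
  exact Finset.single_le_sum (f := fun x ↦ |f x|) (fun _ _ ↦ abs_nonneg _) (Finset.mem_univ x)

omit [MeasurableSpace 𝒳] [MeasurableSingletonClass 𝒳] in
theorem integrable_iSup_eval {μ : Measure (𝒳 → ℝ)} (h : ∀ x, Integrable (fun f ↦ f x) μ) :
    Integrable (fun f ↦ ⨆ x, f x) μ :=
  (integrable_finsetSum Finset.univ fun x _ ↦ (h x).abs).mono'
    measurable_iSup_eval.aestronglyMeasurable
    (Filter.Eventually.of_forall fun f ↦ abs_iSup_le_sum_abs f)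

-- The pathwise core. At a maximizer `w` of `g` the score is the standardized value of `g` at `w`,
-- so the minimal score is at most that. The index `w` depends on `g`, hence the sum of excesses
-- over all points.
omit [MeasurableSpace 𝒳] [MeasurableSingletonClass 𝒳] in
theorem iSup_sub_postMean_le (hk : (Matrix.of k).PosSemidef) (hk1 : ∀ x, k x x = 1)
    (hσ : 0 < σ) (D : Dataset 𝒳 n) {c l : ℝ} (hl : 0 < l) (g : 𝒳 → ℝ) (x : 𝒳)
    (hx : ∀ x', score k σ D g x ≤ score k σ D g x') :
    (⨆ z, g z) - postMean k σ D x ≤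
      l / 2 * (c + ∑ z, excess c ((g z - postMean k σ D z) / postStd k σ D z)) +
        1 / (2 * l) * postVar k σ D x := by
  obtain ⟨w, hw⟩ := exists_eq_ciSup_of_finite (f := g)
  have hv := postVar_pos hk hk1 hσ D x
  have hs : 0 < postStd k σ D x := Real.sqrt_pos.2 hv
  have hs2 : postStd k σ D x ^ 2 = postVar k σ D x := Real.sq_sqrt hv.le
  set s := postStd k σ D x
  -- The score may be negative; its positive part can be squared monotonically.
  set r := max (score k σ D g x) 0
  set Z : 𝒳 → ℝ := fun z ↦ (g z - postMean k σ D z) / postStd k σ D z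
  have hr : r ^ 2 ≤ c + ∑ z, excess c (Z z) := by
    have hsw : score k σ D g w = Z w := by rw [score, ← hw]
    calc r ^ 2 ≤ max (Z w) 0 ^ 2 := by
          refine pow_le_pow_left₀ (le_max_right _ _) (max_le_max_right 0 ?_) 2
          rw [← hsw]; exact hx w
      _ ≤ c + excess c (Z w) := sq_max_le_add_excess c _
      _ ≤ _ := by
          gcongr
          exact Finset.single_le_sum (f := fun z ↦ excess c (Z z)) (fun _ _ ↦ excess_nonneg _ _)
            (Finset.mem_univ w)
  have h1 : (⨆ z, g z) - postMean k σ D x = score k σ D g x * s := by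
    rw [score, div_mul_cancel₀ _ hs.ne']
  have h2 : score k σ D g x * s ≤ r * s := by gcongr; exact le_max_left _ _
  have h3 : r * s ≤ l / 2 * r ^ 2 + 1 / (2 * l) * s ^ 2 := by
    have : 0 ≤ (l * r - s) ^ 2 / (2 * l) := by positivity
    have h4 : (l * r - s) ^ 2 / (2 * l) = l / 2 * r ^ 2 + 1 / (2 * l) * s ^ 2 - r * s := by
      field_simp; ring
    linarith
  rw [← hs2, h1]
  refine (h2.trans h3).trans ?_
  gcongr

omit [MeasurableSpace 𝒳] [MeasurableSingletonClass 𝒳] [Nonempty 𝒳] in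
theorem measurable_score (D : Dataset 𝒳 n) (x' : 𝒳) :
    Measurable (fun g ↦ score k σ D g x') :=
  (measurable_iSup_eval.sub_const _).div_const _

omit [Nonempty 𝒳] in
theorem ae_compProd_score_le (μ : Measure (𝒳 → ℝ)) (D : Dataset 𝒳 n) (κ : Kernel (𝒳 → ℝ) 𝒳)
    (hκ : ∀ g, ∀ᵐ x ∂κ g, ∀ x', score k σ D g x ≤ score k σ D g x') :
    ∀ᵐ p ∂(μ ⊗ₘ κ), ∀ x', score k σ D p.1 p.2 ≤ score k σ D p.1 x' := by
  refine Measure.ae_compProd_of_ae_ae ?_ (Filter.Eventually.of_forall hκ)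
  rw [Set.ofPred_forall]
  refine MeasurableSet.iInter fun x' ↦ measurableSet_le ?_ ?_
  · exact measurable_from_prod_countable_left fun x ↦ measurable_score D x
  · exact (measurable_score D x').comp measurable_fst

/-- The expected instantaneous regret given a dataset. -/
theorem integral_regret_gpKernel_le (hk : (Matrix.of k).PosSemidef) (hk1 : ∀ x, k x x = 1)
    (hσ : 0 < σ) (D : Dataset 𝒳 n) (κ : Kernel (𝒳 → ℝ) 𝒳) [IsMarkovKernel κ]
    (hκ : ∀ g, ∀ᵐ x ∂κ g, ∀ x', score k σ D g x ≤ score k σ D g x')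
    {c l : ℝ} (hc : 0 ≤ c) (hl : 0 < l) :
    ∫ f, ∫ x, ((⨆ z, f z) - f x) ∂(gpKernel k σ n D ⊗ₘ κ).snd ∂gpKernel k σ n D ≤
      l / 2 * (c + Fintype.card 𝒳 * Real.exp (-(c / 2))) +
        1 / (2 * l) * ∫ x, postVar k σ D x ∂(gpKernel k σ n D ⊗ₘ κ).snd := by
  set G := gpKernel k σ n D
  set P := G ⊗ₘ κ
  have hfst : P.map Prod.fst = G := Measure.fst_compProd G κ
  have hev := integrable_eval_gpKernel hk hσ D
  have hsup := integrable_iSup_eval hev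
  -- Given the dataset, `x` is independent of `f`, so `f x` averages to the posterior mean at `x`.
  have hlhs : ∫ f, ∫ x, ((⨆ z, f z) - f x) ∂P.snd ∂G =
      ∫ f, (⨆ z, f z) ∂G - ∫ x, postMean k σ D x ∂P.snd := by
    have h1 (f : 𝒳 → ℝ) : ∫ x, ((⨆ z, f z) - f x) ∂P.snd =
        (⨆ z, f z) - ∑ x, P.snd.real {x} * f x := by
      rw [integral_sub (integrable_const _) .of_finite, integral_const,
        integral_fintype (f := f) .of_finite]
      simp
    simp only [h1]
    rw [integral_sub hsup (integrable_finsetSum _ fun x _ ↦ (hev x).const_mul _),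
      integral_finsetSum _ fun x _ ↦ (hev x).const_mul _,
      integral_fintype (f := postMean k σ D) .of_finite]
    simp only [integral_const_mul, integral_eval_gpKernel hk hσ, smul_eq_mul, G]
  have hZm (z : 𝒳) : Measurable
    (fun f : 𝒳 → ℝ ↦ (f z - postMean k σ D z) / postStd k σ D z) := by fun_prop
  obtain ⟨he1, he2⟩ := integrable_excess_gaussianReal hc
  have hex (z : 𝒳) : Integrable
      (fun f ↦ excess c ((f z - postMean k σ D z) / postStd k σ D z)) G := by
    rw [← gpKernel_map_standardize hk hk1 hσ D z] at he1
    exact he1.comp_measurable (hZm z)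
  have hexi (z : 𝒳) : ∫ f, excess c ((f z - postMean k σ D z) / postStd k σ D z) ∂G ≤
      Real.exp (-(c / 2)) := by
    rw [← gpKernel_map_standardize hk hk1 hσ D z, integral_map (hZm z).aemeasurable
      (measurable_excess c).aestronglyMeasurable] at he2
    exact he2
  have hbase : Integrable (fun f ↦ c + ∑ z, excess c ((f z - postMean k σ D z) / postStd k σ D z))
      G := (integrable_const c).add (integrable_finsetSum _ fun z _ ↦ hex z)
  have hfP {φ : (𝒳 → ℝ) → ℝ} (h : Integrable φ G) : Integrable (fun p ↦ φ p.1) P := by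
    rw [← hfst] at h
    exact h.comp_measurable measurable_fst
  have hfPi {φ : (𝒳 → ℝ) → ℝ} (h : Integrable φ G) : ∫ p, φ p.1 ∂P = ∫ f, φ f ∂G := by
    conv_rhs => rw [← hfst]
    rw [integral_map measurable_fst.aemeasurable]
    rw [hfst]; exact h.aestronglyMeasurable
  have hsP (φ : 𝒳 → ℝ) : Integrable (fun p ↦ φ p.2) P :=
    (Integrable.of_finite (μ := P.map Prod.snd) (f := φ)).comp_measurable measurable_snd
  have hsPi (φ : 𝒳 → ℝ) : ∫ p, φ p.2 ∂P = ∫ x, φ x ∂P.snd :=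
    (integral_map measurable_snd.aemeasurable Measurable.of_discrete.aestronglyMeasurable).symm
  -- Since `f` and `g` have the same law `G`, the mean of `max f` is that of `max g`; everything now
  -- lives on the joint law `P` of `(g, x)`.
  rw [hlhs, ← hfPi hsup, ← hsPi, ← hsPi, ← integral_sub (hfP hsup) (hsP _)]
  calc _ ≤ ∫ p, (l / 2 * (c + ∑ z, excess c ((p.1 z - postMean k σ D z) / postStd k σ D z)) +
        1 / (2 * l) * postVar k σ D p.2) ∂P := by
        refine integral_mono_ae ((hfP hsup).sub (hsP _))
          (((hfP hbase).const_mul _).add ((hsP _).const_mul _)) ?_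
        filter_upwards [ae_compProd_score_le G D κ hκ] with p hp
        exact iSup_sub_postMean_le hk hk1 hσ D hl p.1 p.2 hp
    _ = l / 2 * ∫ f, (c + ∑ z, excess c ((f z - postMean k σ D z) / postStd k σ D z)) ∂G +
        1 / (2 * l) * ∫ p, postVar k σ D p.2 ∂P := by
        rw [integral_add ((hfP hbase).const_mul _) ((hsP _).const_mul _), integral_const_mul,
          integral_const_mul, hfPi hbase]
    _ ≤ _ := by
        gcongr
        rw [integral_add (integrable_const c) (integrable_finsetSum _ fun z _ ↦ hex z),
          integral_finsetSum _ fun z _ ↦ hex z]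
        simp only [integral_const, probReal_univ, one_smul]
        gcongr
        refine (Finset.sum_le_sum fun z _ ↦ hexi z).trans (le_of_eq ?_)
        simp

variable {ρ : Measure (Dataset 𝒳 n × (𝒳 → ℝ))} [IsProbabilityMeasure ρ]

theorem integrable_iSup_sub_compProd (hev : ∀ x, Integrable (fun f ↦ f x) ρ.snd)
    (q : Kernel (Dataset 𝒳 n) 𝒳) [IsMarkovKernel q] :
    Integrable (fun p ↦ (⨆ z, p.1.2 z) - p.1.2 p.2) (ρ ⊗ₘ q.comap Prod.fst measurable_fst) := by
  have hfst : (ρ ⊗ₘ q.comap Prod.fst measurable_fst).map Prod.fst = ρ := Measure.fst_compProd _ _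
  have h2 (x : 𝒳) : Integrable (fun p ↦ p.1.2 x) (ρ ⊗ₘ q.comap Prod.fst measurable_fst) := by
    have h := (hev x).comp_measurable (μ := ρ) (f := Prod.snd) measurable_snd
    rw [← hfst] at h
    exact h.comp_measurable measurable_fst
  have hsum := integrable_finsetSum Finset.univ fun x _ ↦ (h2 x).abs
  refine (hsum.add hsum).mono' ?_ (Filter.Eventually.of_forall fun p ↦ ?_)
  · exact ((measurable_iSup_eval.comp (measurable_snd.comp measurable_fst)).sub
      (measurable_eval_uncurry.comp ((measurable_snd.comp measurable_fst).prodMk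
        measurable_snd))).aestronglyMeasurable
  · refine (abs_sub _ _).trans (add_le_add (abs_iSup_le_sum_abs _) ?_)
    exact Finset.single_le_sum (f := fun x ↦ |p.1.2 x|) (fun _ _ ↦ abs_nonneg _)
      (Finset.mem_univ p.2)

theorem IsPosteriorLaw.integral_regret_le (hk : (Matrix.of k).PosSemidef) (hk1 : ∀ x, k x x = 1)
    (hσ : 0 < σ) (hρ : IsPosteriorLaw k σ ρ) (hev : ∀ x, Integrable (fun f ↦ f x) ρ.snd)
    (sel : Kernel (Dataset 𝒳 n × (𝒳 → ℝ)) 𝒳) [IsMarkovKernel sel]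
    (hsel : ∀ D g, ∀ᵐ x ∂sel (D, g), ∀ x', score k σ D g x ≤ score k σ D g x')
    {c l : ℝ} (hc : 0 ≤ c) (hl : 0 < l) :
    ∫ p, ((⨆ z, p.1.2 z) - p.1.2 p.2)
        ∂(ρ ⊗ₘ (queryKernel ρ sel).comap Prod.fst measurable_fst) ≤
      l / 2 * (c + Fintype.card 𝒳 * Real.exp (-(c / 2))) + 1 / (2 * l) *
        ∫ p, postVar k σ p.1.1 p.2 ∂(ρ ⊗ₘ (queryKernel ρ sel).comap Prod.fst measurable_fst) := by
  set q := queryKernel ρ sel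
  have hint := integrable_iSup_sub_compProd hev q
  have hV : Integrable (fun p ↦ postVar k σ p.1.1 p.2) (ρ ⊗ₘ q.comap Prod.fst measurable_fst) :=
    integrable_postVar hk hk1 hσ (by fun_prop) (by fun_prop)
  have hV2 : Integrable (fun p ↦ postVar k σ p.1 p.2) (ρ.fst ⊗ₘ q) :=
    integrable_postVar hk hk1 hσ (by fun_prop) (by fun_prop)
  have hH : Integrable (fun D ↦ ∫ x, postVar k σ D x ∂q D) ρ.fst := hV2.integral_compProd
  have hint2 : Integrable (fun p : Dataset 𝒳 n × (𝒳 → ℝ) ↦ ∫ x, ((⨆ z, p.2 z) - p.2 x) ∂q p.1)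
      (ρ.fst ⊗ₘ gpKernel k σ n) := by
    rw [← hρ]; exact hint.integral_compProd
  have hVi : ∫ p, postVar k σ p.1.1 p.2 ∂(ρ ⊗ₘ q.comap Prod.fst measurable_fst) =
      ∫ D, ∫ x, postVar k σ D x ∂q D ∂ρ.fst := by
    rw [Measure.integral_compProd hV, Measure.fst, integral_map measurable_fst.aemeasurable
      hH.aestronglyMeasurable]
    rfl
  have hRi : ∫ p, ((⨆ z, p.1.2 z) - p.1.2 p.2) ∂(ρ ⊗ₘ q.comap Prod.fst measurable_fst) =
      ∫ D, ∫ f, ∫ x, ((⨆ z, f z) - f x) ∂q D ∂gpKernel k σ n D ∂ρ.fst := by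
    rw [Measure.integral_compProd hint, ← Measure.integral_compProd hint2, ← hρ]
    rfl
  rw [hVi, hRi, ← integral_const_mul]
  calc _ ≤ ∫ D, (l / 2 * (c + Fintype.card 𝒳 * Real.exp (-(c / 2))) +
        1 / (2 * l) * ∫ x, postVar k σ D x ∂q D) ∂ρ.fst := by
        refine integral_mono_ae hint2.integral_compProd ((integrable_const _).add
          (hH.const_mul _)) ?_
        filter_upwards [hρ.queryKernel_ae_eq sel] with D hD
        simp only [q, hD]
        exact integral_regret_gpKernel_le hk hk1 hσ D _
          (fun g ↦ by rw [Kernel.sectR_apply]; exact hsel D g) hc hl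
    _ = _ := by
        rw [integral_add (integrable_const _) (hH.const_mul _)]
        simp

end OneStep

/-! ### Summation over time and choice of constants -/

section CumulativeRegret

variable {𝒳 : Type*} [Fintype 𝒳] [MeasurableSpace 𝒳] [MeasurableSingletonClass 𝒳] {k : 𝒳 → 𝒳 → ℝ}
  {σ : ℝ}

theorem map_init_last_extendLaw {n : ℕ} (σ : ℝ) (ρ : Measure (Dataset 𝒳 n × (𝒳 → ℝ))) [SFinite ρ]
    (q : Kernel (Dataset 𝒳 n) 𝒳) [IsMarkovKernel q] :
    (extendLaw σ ρ q).map (fun p ↦ (((Fin.init p.1 : Dataset 𝒳 n), p.2), (p.1 (Fin.last n)).1)) =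
      ρ ⊗ₘ q.comap Prod.fst measurable_fst := by
  have hm : Measurable (fun p : Dataset 𝒳 (n + 1) × (𝒳 → ℝ) ↦
      (((Fin.init p.1 : Dataset 𝒳 n), p.2), (p.1 (Fin.last n)).1)) :=
    ((measurable_init.comp measurable_fst).prodMk measurable_snd).prodMk (by fun_prop)
  refine Measure.ext_of_lintegral _ fun φ hφ ↦ ?_
  have hφm : Measurable (fun p : Dataset 𝒳 (n + 1) × (𝒳 → ℝ) ↦
    φ (((Fin.init p.1 : Dataset 𝒳 n), p.2), (p.1 (Fin.last n)).1)) := hφ.comp hm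
  rw [lintegral_map hφ hm, lintegral_extendLaw _ _ _ hφm, Measure.lintegral_compProd hφ]
  simp

theorem snd_extendLaw {n : ℕ} (σ : ℝ) (ρ : Measure (Dataset 𝒳 n × (𝒳 → ℝ))) [SFinite ρ]
    (q : Kernel (Dataset 𝒳 n) 𝒳) [IsMarkovKernel q] : (extendLaw σ ρ q).snd = ρ.snd := by
  conv_rhs => rw [← map_init_extendLaw σ ρ q]
  have hm : Measurable (fun p : Dataset 𝒳 (n + 1) × (𝒳 → ℝ) ↦
      ((Fin.init p.1 : Dataset 𝒳 n), p.2)) :=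
    (measurable_init.comp measurable_fst).prodMk measurable_snd
  rw [Measure.snd, Measure.snd, Measure.map_map measurable_snd hm]
  rfl

omit [MeasurableSpace 𝒳] [MeasurableSingletonClass 𝒳] in
theorem integrable_eval_gpLaw {S : 𝒳 → 𝒳 → ℝ} (hS : (Matrix.of S).PosSemidef) (x : 𝒳) :
    Integrable (fun f ↦ f x) (gpLaw S) := by
  have h : Integrable id ((gpLaw S).map (fun f ↦ f x)) := by
    rw [gpLaw_map_eval hS]
    exact (memLp_id_gaussianReal 1).integrable le_rfl
  exact h.comp_measurable (by fun_prop)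

variable {n₀ : ℕ} (x₀ : Fin n₀ → 𝒳) (sel : ∀ t : ℕ, Kernel (Dataset 𝒳 (n₀ + t) × (𝒳 → ℝ)) 𝒳)
  [∀ t, IsMarkovKernel (sel t)]

theorem snd_runLaw (k : 𝒳 → 𝒳 → ℝ) (σ : ℝ) (T : ℕ) :
    (runLaw k σ x₀ sel T : Measure (Dataset 𝒳 (n₀ + T) × (𝒳 → ℝ))).snd = gpLaw k := by
  induction T with
  | zero => exact snd_initLaw k σ x₀
  | succ T ih => exact (snd_extendLaw σ _ (queryKernel _ (sel T))).trans ih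

/-- With `l` fixed, the one-step bounds are additive in time. Integrability is carried along because
splitting off the last step requires it. -/
theorem integrable_regret_and_varSum_and_integral_regret_le [Nonempty 𝒳]
    (hk : (Matrix.of k).PosSemidef) (hk1 : ∀ x, k x x = 1) (hσ : 0 < σ)
    (hsel : IsPIMSRule k σ sel) {c : ℝ} (hc : 0 ≤ c) (T : ℕ) :
    Integrable regret (runLaw k σ x₀ sel T : Measure (Dataset 𝒳 (n₀ + T) × (𝒳 → ℝ))) ∧
    Integrable (fun p ↦ varSum k σ n₀ T p.1)
      (runLaw k σ x₀ sel T : Measure (Dataset 𝒳 (n₀ + T) × (𝒳 → ℝ))) ∧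
    ∀ l : ℝ, 0 < l →
      ∫ p, regret p ∂(runLaw k σ x₀ sel T : Measure (Dataset 𝒳 (n₀ + T) × (𝒳 → ℝ))) ≤
        l / 2 * (T * (c + Fintype.card 𝒳 * Real.exp (-(c / 2)))) + 1 / (2 * l) *
          ∫ p, varSum k σ n₀ T p.1
            ∂(runLaw k σ x₀ sel T : Measure (Dataset 𝒳 (n₀ + T) × (𝒳 → ℝ))) := by
  induction T with
  | zero =>
    have h : (regret : Dataset 𝒳 (n₀ + 0) × (𝒳 → ℝ) → ℝ) = fun _ ↦ 0 := by funext p; simp [regret]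
    rw [h]
    simp [varSum]
  | succ T ih =>
    obtain ⟨ih1, ih2, ih3⟩ := ih
    set ρ := (runLaw k σ x₀ sel T : Measure (Dataset 𝒳 (n₀ + T) × (𝒳 → ℝ))) with hρ_def
    have hρ : IsPosteriorLaw k σ ρ := isPosteriorLaw_runLaw hk hσ x₀ sel T
    have hev : ∀ x, Integrable (fun f : 𝒳 → ℝ ↦ f x) ρ.snd := by
      rw [hρ_def, snd_runLaw]; exact integrable_eval_gpLaw hk
    set q := queryKernel ρ (sel T)
    set Q := ρ ⊗ₘ q.comap Prod.fst measurable_fst with hQ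
    set π : Dataset 𝒳 (n₀ + T + 1) × (𝒳 → ℝ) → (Dataset 𝒳 (n₀ + T) × (𝒳 → ℝ)) × 𝒳 :=
      fun p ↦ ((Fin.init p.1, p.2), (p.1 (Fin.last (n₀ + T))).1) with hπ
    have hπm : Measurable π :=
      ((measurable_init.comp measurable_fst).prodMk measurable_snd).prodMk (by fun_prop)
    have hrun : (runLaw k σ x₀ sel (T + 1) : Measure (Dataset 𝒳 (n₀ + T + 1) × (𝒳 → ℝ))) =
      extendLaw σ ρ q := rfl
    have hmap : (extendLaw σ ρ q).map π = Q := map_init_last_extendLaw σ ρ q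
    have hfst : Q.map Prod.fst = ρ := Measure.fst_compProd _ _
    set r : (Dataset 𝒳 (n₀ + T) × (𝒳 → ℝ)) × 𝒳 → ℝ := fun p ↦ (⨆ z, p.1.2 z) - p.1.2 p.2
    set v : (Dataset 𝒳 (n₀ + T) × (𝒳 → ℝ)) × 𝒳 → ℝ := fun p ↦ postVar k σ p.1.1 p.2
    have hreg : (regret (𝒳 := 𝒳) (n₀ := n₀) (T := T + 1)) =
        (fun p ↦ regret p.1 + r p) ∘ π := by
      funext p
      exact Fin.sum_univ_castSucc (fun t : Fin (T + 1) ↦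
        (⨆ x, p.2 x) - p.2 (p.1 (Fin.natAdd n₀ t)).1)
    have hvar : (fun p : Dataset 𝒳 (n₀ + T + 1) × (𝒳 → ℝ) ↦ varSum k σ n₀ (T + 1) p.1) =
        (fun p ↦ varSum k σ n₀ T p.1.1 + v p) ∘ π := rfl
    have hr : Integrable r Q := integrable_iSup_sub_compProd hev q
    have hv : Integrable v Q := integrable_postVar hk hk1 hσ (by fun_prop) (by fun_prop)
    have hlift {φ : Dataset 𝒳 (n₀ + T) × (𝒳 → ℝ) → ℝ} (h : Integrable φ ρ) :
        Integrable (fun p ↦ φ p.1) Q ∧ ∫ p, φ p.1 ∂Q = ∫ p, φ p ∂ρ := by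
      rw [← hfst] at h
      refine ⟨h.comp_measurable measurable_fst, ?_⟩
      conv_rhs => rw [← hfst]
      exact (integral_map measurable_fst.aemeasurable h.aestronglyMeasurable).symm
    obtain ⟨hr1, hr2⟩ := hlift ih1
    obtain ⟨hv1, hv2⟩ := hlift ih2
    have hR : Integrable (fun p ↦ regret p.1 + r p) Q := hr1.add hr
    have hV : Integrable (fun p ↦ varSum k σ n₀ T p.1.1 + v p) Q := hv1.add hv
    have hR' := hR
    have hV' := hV
    rw [← hmap] at hR' hV'
    have e1 : ∫ p, regret (n₀ := n₀) (T := T + 1) p ∂(extendLaw σ ρ q) = ∫ p, regret p ∂ρ + ∫ p, r p ∂Q := by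
      rw [hreg, ← hr2, ← integral_add hr1 hr, ← hmap]
      exact (integral_map hπm.aemeasurable hR'.aestronglyMeasurable).symm
    have e2 : ∫ p, varSum k σ n₀ (T + 1) p.1 ∂(extendLaw σ ρ q) =
        ∫ p, varSum k σ n₀ T p.1 ∂ρ + ∫ p, v p ∂Q := by
      rw [← hv2, ← integral_add hv1 hv, ← hmap]
      exact (integral_map hπm.aemeasurable hV'.aestronglyMeasurable).symm
    refine ⟨?_, ?_, fun l hl ↦ ?_⟩
    · change Integrable (regret (𝒳 := 𝒳) (n₀ := n₀) (T := T + 1)) (extendLaw σ ρ q)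
      rw [hreg]
      exact hR'.comp_measurable hπm
    · change Integrable (fun p : Dataset 𝒳 (n₀ + T + 1) × (𝒳 → ℝ) ↦ varSum k σ n₀ (T + 1) p.1)
        (extendLaw σ ρ q)
      rw [hvar]
      exact hV'.comp_measurable hπm
    · change ∫ p, regret (n₀ := n₀) (T := T + 1) p ∂(extendLaw σ ρ q) ≤ _ + _ *
        ∫ p, varSum k σ n₀ (T + 1) p.1 ∂(extendLaw σ ρ q)
      rw [e1, e2]
      have h1 := ih3 l hl
      have h2 : ∫ p, r p ∂Q ≤ l / 2 * (c + Fintype.card 𝒳 * Real.exp (-(c / 2))) +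
          1 / (2 * l) * ∫ p, v p ∂Q :=
        hρ.integral_regret_le hk hk1 hσ hev (sel T) (hsel T) hc hl
      push_cast
      linarith

theorem integrable_regret_and_bcr_le [Nonempty 𝒳] (hk : (Matrix.of k).PosSemidef)
    (hk1 : ∀ x, k x x = 1) (hσ : 0 < σ) (hsel : IsPIMSRule k σ sel) (T : ℕ) :
    Integrable regret (runLaw k σ x₀ sel T : Measure (Dataset 𝒳 (n₀ + T) × (𝒳 → ℝ))) ∧
    bcr k σ x₀ sel T ≤ √((2 / Real.log (1 + (σ ^ 2)⁻¹)) *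
      (2 + 2 * Real.log ((Fintype.card 𝒳 : ℝ) / 2)) * T * maxInfoGain k σ T) := by
  refine ⟨(integrable_regret_and_varSum_and_integral_regret_le x₀ sel hk hk1 hσ hsel le_rfl T).1, ?_⟩
  -- For a single point `2 log(|𝒳|/2)` is negative and the tail bound does not apply, but the regret
  -- vanishes.
  rcases subsingleton_or_nontrivial 𝒳 with hsub | hnt
  · have h : (regret : Dataset 𝒳 (n₀ + T) × (𝒳 → ℝ) → ℝ) = fun _ ↦ 0 := by
      funext p
      refine Finset.sum_eq_zero fun t _ ↦ sub_eq_zero.2 ?_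
      obtain ⟨x, hx⟩ := exists_eq_ciSup_of_finite (f := p.2)
      rw [← hx]
      exact congrArg p.2 (Subsingleton.elim _ _)
    rw [bcr, h, integral_zero]
    exact Real.sqrt_nonneg _
  · have hN : (2 : ℝ) ≤ Fintype.card 𝒳 := by exact_mod_cast Fintype.one_lt_card
    have hlog : 0 ≤ Real.log ((Fintype.card 𝒳 : ℝ) / 2) := Real.log_nonneg (by linarith)
    -- This `c` minimizes `c + |𝒳| exp(-c/2)`; the second term becomes `2`.
    obtain ⟨-, hV, hle⟩ := integrable_regret_and_varSum_and_integral_regret_le x₀ sel hk hk1 hσ hsel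
      (c := 2 * Real.log ((Fintype.card 𝒳 : ℝ) / 2)) (by positivity) T
    have hC : 2 * Real.log ((Fintype.card 𝒳 : ℝ) / 2) + Fintype.card 𝒳 *
        Real.exp (-(2 * Real.log ((Fintype.card 𝒳 : ℝ) / 2) / 2)) =
        2 + 2 * Real.log ((Fintype.card 𝒳 : ℝ) / 2) := by
      rw [mul_div_cancel_left₀ _ two_ne_zero, Real.exp_neg, Real.exp_log (by positivity)]
      field_simp
      ring
    have hlog' : 0 < Real.log (1 + (σ ^ 2)⁻¹) :=
      Real.log_pos (by have : 0 < (σ ^ 2)⁻¹ := by positivity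
                       linarith)
    have hγ : 0 ≤ maxInfoGain k σ T := ENNReal.toReal_nonneg
    have h := le_sqrt_mul_of_forall_le (R := bcr k σ x₀ sel T)
      (A := T * (2 + 2 * Real.log ((Fintype.card 𝒳 : ℝ) / 2)))
      (B := 2 / Real.log (1 + (σ ^ 2)⁻¹) * maxInfoGain k σ T) (by positivity) (by positivity)
      (fun l hl ↦ by
        refine (hle l hl).trans ?_
        rw [hC]
        gcongr
        refine (integral_mono hV (integrable_const (2 / Real.log (1 + (σ ^ 2)⁻¹) *
          maxInfoGain k σ T)) fun p ↦ varSum_le hk hk1 hσ p.1).trans (le_of_eq ?_)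
        simp)
    refine h.trans (le_of_eq ?_)
    congr 1
    ring

end CumulativeRegret

end PIMS

end

theorem mainTheorem2 {d : ℕ} (X : Finset (EuclideanSpace ℝ (Fin d))) (hX : X.Nonempty)
    (k : X → X → ℝ) (hk_psd : (Matrix.of k).PosSemidef)
    (hk_stat : ∃ κ : EuclideanSpace ℝ (Fin d) → ℝ, ∀ x x' : X, k x x' = κ (x - x'))
    (hk_one : ∀ x, k x x = 1)
    (σ : ℝ) (hσ : 0 < σ)
    {n₀ : ℕ} (x₀ : Fin n₀ → X)
    (sel : ∀ t : ℕ, Kernel (PIMS.Dataset X (n₀ + t) × (X → ℝ)) X) [∀ t, IsMarkovKernel (sel t)]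
    (hsel : PIMS.IsPIMSRule k σ sel) (T : ℕ) :
    Integrable PIMS.regret
      (PIMS.runLaw k σ x₀ sel T : Measure (PIMS.Dataset X (n₀ + T) × (X → ℝ))) ∧
    PIMS.bcr k σ x₀ sel T ≤
      Real.sqrt ((2 / Real.log (1 + (σ ^ 2)⁻¹)) * (2 + 2 * Real.log ((X.card : ℝ) / 2)) * T *
        PIMS.maxInfoGain k σ T) := by
  have := hX.coe_sort
  have h := PIMS.integrable_regret_and_bcr_le x₀ sel hk_psd hk_one hσ hsel T
  rwa [Fintype.card_coe] at h
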